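/- A binary sequence of length $n\ge 1$ is $A=(a_0,\dots,a_{n-1})\in\{-1,1\}^n$; write $A(z)=\sum_{j=0}^{n-1}a_jz^j$ and extend $a_j$ to all $j\in\mathbb{Z}$ by $a_{j+n}=a_j$. For $t>1$, the merit factor of a binary sequence $B=(b_0,\dots,b_{t-1})$ is \[F(B)=\frac{t^2}{2\sum_{u=1}^{t-1}c_u^2},\qquad c_u=\sum_{j=0}^{t-u-1}b_jb_{j+u}.\] For integers $r$ and $t\ge 0$ let $A^{r,t}=(a_r,a_{r+1},\dots,a_{r+t-1})$. Let $N(A)$ and $P(A)$ be the binary sequences of length $4n$ whose entries, for $0\le j<4n$, are $(-1)^{j(j-1)/2}a_j$ and $(-1)^{j(j-1)^2/2}a_j$, respectively. With $\epsilon_k=e^{2\pi ik/n}$, define for $a,b,c\in\mathbb{Z}/n\mathbb{Z}$ \[L_A(a,b,c)=\frac{1}{n^3}\sum_{k\in\mathbb{Z}/n\mathbb{Z}}A(\epsilon_k)A(\epsilon_{k+a})\overline{A(\epsilon_{k+b})}\,\overline{A(\epsilon_{k+c})},\] and let $I_n(a,b,c)=1$ if one of $a,b,c$ is zero and the other two are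 equal, and $I_n(a,b,c)=0$ otherwise. For real $R$ and $T>0$ define $g(R,T)$ by \[\frac{1}{g(R,T)}=1-\frac{4T}{3}+4\sum_{m=1}^{\infty}\max\Big(0,1-\frac{m}{T}\Big)^2+\sum_{m\in\mathbb{Z}}\max\Big(0,1-\Big|1+\frac{2R-m}{T}\Big|\Big)^2.\] **Theorem.** Let $n$ take values in an infinite set of positive integers. For each $n$, let $V_n$ be a binary sequence of length $n$, and suppose that, as $n\to\infty$, \[(\log n)^3\max_{a,b,c\in\mathbb{Z}/n\mathbb{Z}}\big|L_{V_n}(a,b,c)-I_n(a,b,c)\big|\to 0.\] Let $R$ and $T>0$ be real, and let $r$ and $t\ge 0$ be integers that may depend on $n$. Then the following hold as $n\to\infty$. (i) If $r/n\to R$ and $t/n\to T$, then $F(V_n^{r,t})\to g(R,T)$. (ii) If each $n$ is odd, $r/(2n)\to R$ and $t/(2n)\to T$, then $F(N(V_n)^{r,t})\to g(R+\tfrac14,T)$. (iii) If each $n$ is odd, $r/(4n)\to R$ and $t/(4n)\to T$, then $F(P(V_n)^{r,t})\to g(R,T)$. -/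

import Mathlib

open Filter Topology

noncomputable section

/-- A binary sequence `(a_0, …, a_{n-1})` of length `n`; the units of `ℤ` are `1` and `-1`. -/
abbrev BinarySeq (n : ℕ) : Type := Fin n → ℤˣ

namespace BinarySeq

/-- The aperiodic autocorrelation `c_u = ∑_{j=0}^{t-u-1} a_j a_{j+u}`. -/
def autocorr {t : ℕ} (a : BinarySeq t) (u : ℕ) : ℤ :=
  ∑ j : Fin (t - u),
    (a ⟨j, by have := j.isLt; omega⟩ : ℤ) * (a ⟨j + u, by have := j.isLt; omega⟩ : ℤ)

/-- The merit factor `F(A) = t² / (2 ∑_{u=1}^{t-1} c_u²)`. The denominator is positive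
as soon as `t > 1`, because `c_{t-1} = ±1`. -/
def meritFactor {t : ℕ} (a : BinarySeq t) : ℝ :=
  (t : ℝ) ^ 2 / (2 * ∑ u ∈ Finset.Icc 1 (t - 1), (autocorr a u : ℝ) ^ 2)

/-- The extension of `a` to all integer indices with `a_{j+n} = a_j`. -/
def periodicExt {n : ℕ} [NeZero n] (a : BinarySeq n) (j : ℤ) : ℤˣ :=
  a ⟨(j % (n : ℤ)).toNat, by
    have hn : (0 : ℤ) < n := by exact_mod_cast Nat.pos_of_ne_zero (NeZero.ne n)
    have h1 := Int.emod_nonneg j hn.ne'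
    have h2 := Int.emod_lt_of_pos j hn
    omega⟩

/-- The coefficient sequence of `A^{r,t}(z) = ∑_{j=0}^{t-1} a_{j+r} z^j`. -/
def rotate {n : ℕ} [NeZero n] (a : BinarySeq n) (r : ℤ) (t : ℕ) : BinarySeq t :=
  fun j => periodicExt a ((j : ℕ) + r)

/-- The coefficient sequence of `N(A)(z) = ∑_{j=0}^{4n-1} (-1)^{j(j-1)/2} a_j z^j`
(the signs are `+,+,-,-,+,+,-,-,…`). -/
def negaperiodic {n : ℕ} [NeZero n] (a : BinarySeq n) : BinarySeq (4 * n) :=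
  fun j => (-1) ^ ((j : ℕ) * ((j : ℕ) - 1) / 2) * periodicExt a (j : ℕ)

/-- The coefficient sequence of `P(A)(z) = ∑_{j=0}^{4n-1} (-1)^{j(j-1)²/2} a_j z^j`
(the signs are `+,+,-,+,+,+,-,+,…`). -/
def periodic {n : ℕ} [NeZero n] (a : BinarySeq n) : BinarySeq (4 * n) :=
  fun j => (-1) ^ ((j : ℕ) * ((j : ℕ) - 1) ^ 2 / 2) * periodicExt a (j : ℕ)

/-- The polynomial function `A(z) = ∑_{j=0}^{n-1} a_j z^j`. -/
def polyEval {n : ℕ} (a : BinarySeq n) (z : ℂ) : ℂ :=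
  ∑ j : Fin n, ((a j : ℤ) : ℂ) * z ^ (j : ℕ)

/-- `L_A(a,b,c) = n⁻³ ∑_k A(ε_k) A(ε_{k+a}) conj(A(ε_{k+b})) conj(A(ε_{k+c}))`,
where `ε_k = ZMod.stdAddChar k = exp(2πik/n)`. -/
def spectralL {n : ℕ} [NeZero n] (A : BinarySeq n) (a b c : ZMod n) : ℂ :=
  1 / (n : ℂ) ^ 3 * ∑ k : ZMod n,
    A.polyEval (ZMod.stdAddChar k) * A.polyEval (ZMod.stdAddChar (k + a)) *
      (starRingEnd ℂ) (A.polyEval (ZMod.stdAddChar (k + b))) *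
      (starRingEnd ℂ) (A.polyEval (ZMod.stdAddChar (k + c)))

end BinarySeq

open Classical in
/-- `I_n(a,b,c)` is `1` if one of `a, b, c` is zero and the other two are equal,
and `0` otherwise. -/
def indicatorI {n : ℕ} (a b c : ZMod n) : ℂ :=
  if (a = 0 ∧ b = c) ∨ (b = 0 ∧ a = c) ∨ (c = 0 ∧ a = b) then 1 else 0

/-- `max_{a,b,c ∈ ℤ/nℤ} |L_A(a,b,c) - I_n(a,b,c)|`, a supremum over a finite nonempty set. -/
def maxDeviation {n : ℕ} [NeZero n] (A : BinarySeq n) : ℝ :=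
  ⨆ x : ZMod n × ZMod n × ZMod n,
    ‖A.spectralL x.1 x.2.1 x.2.2 - indicatorI x.1 x.2.1 x.2.2‖

/-- The right-hand side of the formula that defines `1 / g(R,T)`, for `T > 0`
(both series then have finitely many nonzero terms). -/
def gRecip (R T : ℝ) : ℝ :=
  1 - 4 * T / 3 + 4 * ∑' m : ℕ+, (max 0 (1 - (m : ℝ) / T)) ^ 2
    + ∑' m : ℤ, (max 0 (1 - |1 + (2 * R - (m : ℝ)) / T|)) ^ 2

/-- The limit function `g(R,T)`. -/
def gLimit (R T : ℝ) : ℝ := 1 / gRecip R T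

end

/-! Adding the squares of all aperiodic autocorrelations, for positive, zero and negative shifts,
gives the additive energy: the sum of `f x₁ * f x₂ * f x₃ * f x₄` over quadruples in an interval of
length `t` with `x₁ + x₂ = x₃ + x₄`. Hence the reciprocal merit factor is the energy divided by `t ^
2`, minus 1. All three constructions have the form `f x = σ x * a_x`, where `a` has period `n` and
the sign pattern `σ` has period 4.

Fourier inversion on `ZMod n` writes each product of four values of `a` as the average `1/n ∑
L(a,b,c) * phase` (`periodicExt_quadruple`). Replacing `L` by `I` leaves three divisibility
conditions on the quadruple and a term `-2/n` (`sum_indicatorI_mul_quadPhase`). The replacement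
costs at most the maximal deviation times `1/n ∑ |∑_x weight * phase|` over all `a, b, c`. Weighted
geometric sums bound the triple sum by a constant times `(n log n) ^ 3` (`sum_norm_twisted_le`), so
the error relative to `t ^ 2` is of order `(log n) ^ 3` times the deviation, and vanishes.

The main terms involve `σ` alone. Its correlations and convolutions on an interval have full size
when the shift lies in a progression modulo `p`, and are at most 4 in modulus otherwise. The two
difference conditions each contribute `1 + 2 ∑_{m ≥ 1}`, the sum condition contributes the series
over `ℤ`, and the `2/n` term contributes `-4T/3`; subtracting 1 gives `gRecip`. The offset `q` of
the convolution progression shifts `R` by `-q / (2p)`. Finally `gRecip_pos` permits taking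
reciprocals of limits. -/

/-! ### Weighted geometric sums -/

/-- A bound for `∑_{v < N} z ^ v` when `‖z‖ = 1` and `N ≤ u`. -/
noncomputable def geomBound (u : ℝ) (z : ℂ) : ℝ := open Classical in if z = 1 then u else 2 / ‖1 - z‖

lemma geomBound_nonneg {u : ℝ} (hu : 0 ≤ u) (z : ℂ) : 0 ≤ geomBound u z := by
  unfold geomBound; split_ifs <;> positivity

lemma geomBound_inv (u : ℝ) {z : ℂ} (hz : ‖z‖ = 1) : geomBound u z⁻¹ = geomBound u z := by
  have h0 : z ≠ 0 := by rintro rfl; simp at hz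
  have : ‖1 - z⁻¹‖ = ‖1 - z‖ := by
    have : 1 - z⁻¹ = -(z⁻¹ * (1 - z)) := by field_simp; ring
    rw [this, norm_neg, norm_mul, norm_inv, hz]; simp
  simp only [geomBound, inv_eq_one, this]

lemma norm_geom_sum_le {u : ℝ} {z : ℂ} (hz : ‖z‖ = 1) {N : ℕ} (hN : (N : ℝ) ≤ u) :
    ‖∑ v ∈ Finset.range N, z ^ v‖ ≤ geomBound u z := by
  unfold geomBound
  split_ifs with h
  · subst h; simpa using hN
  · have h1 : 1 - z ≠ 0 := sub_ne_zero.2 (Ne.symm h)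
    rw [geom_sum_eq h, norm_div, norm_sub_rev z 1]
    gcongr
    calc ‖z ^ N - 1‖ ≤ ‖z ^ N‖ + ‖(1 : ℂ)‖ := norm_sub_le _ _
      _ = 2 := by rw [norm_pow, hz]; norm_num

/-- Summation by parts in inductive form. The constant `w 0` is split off; what remains, shifted by
one, is again a nonnegative monotone weight, and the two bounds add up to the last weight. -/
lemma norm_sum_monotone_mul_pow_le {u : ℝ} {z : ℂ} (hz : ‖z‖ = 1) (N : ℕ) :
    ∀ (w : ℕ → ℝ), Monotone w → 0 ≤ w 0 → ((N + 1 : ℕ) : ℝ) ≤ u →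
    ‖∑ v ∈ Finset.range (N + 1), (w v : ℂ) * z ^ v‖ ≤ w N * geomBound u z := by
  induction N with
  | zero =>
    intro w _ h0 hN
    have := norm_geom_sum_le hz (N := 1) (by simpa using hN)
    simp only [Finset.range_one, Finset.sum_singleton, pow_zero, mul_one, zero_add] at this ⊢
    rw [Complex.norm_real, Real.norm_of_nonneg h0]
    simp only [norm_one] at this
    nlinarith
  | succ N ih =>
    intro w hw h0 hN
    have key : ∑ v ∈ Finset.range (N + 1 + 1), (w v : ℂ) * z ^ v
        = w 0 * ∑ v ∈ Finset.range (N + 1 + 1), z ^ v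
          + z * ∑ v ∈ Finset.range (N + 1), ((w (v + 1) - w 0 : ℝ) : ℂ) * z ^ v := by
      rw [Finset.sum_range_succ' _ (N + 1), Finset.sum_range_succ' _ (N + 1), mul_add,
        Finset.mul_sum, Finset.mul_sum, add_right_comm, ← Finset.sum_add_distrib]
      congr 1
      refine Finset.sum_congr rfl fun v _ => ?_
      push_cast; ring
    have h1 := ih (fun v => w (v + 1) - w 0)
      (fun a b h => sub_le_sub_right (hw (Nat.succ_le_succ h)) _)
      (sub_nonneg.2 (hw (Nat.zero_le _))) (le_trans (by push_cast; linarith) hN)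
    have h2 := norm_geom_sum_le hz hN
    rw [key]
    refine (norm_add_le _ _).trans ?_
    rw [norm_mul, norm_mul, hz, one_mul, Complex.norm_real, Real.norm_of_nonneg h0]
    nlinarith [mul_le_mul_of_nonneg_left h2 h0]

lemma norm_sum_weight_mul_pow_le {u : ℝ} {z : ℂ} (hz : ‖z‖ = 1) {N : ℕ} (hN : (N : ℝ) ≤ u)
    {w : ℕ → ℝ} (hw : Monotone w) (h0 : 0 ≤ w 0) {W : ℝ} (hW : ∀ v < N, w v ≤ W) (hW0 : 0 ≤ W) :
    ‖∑ v ∈ Finset.range N, (w v : ℂ) * z ^ v‖ ≤ W * geomBound u z := by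
  have hu : 0 ≤ u := le_trans (Nat.cast_nonneg N) hN
  cases N with
  | zero => simpa using mul_nonneg hW0 (geomBound_nonneg hu z)
  | succ N =>
    exact (norm_sum_monotone_mul_pow_le hz N w hw h0 hN).trans
      (mul_le_mul_of_nonneg_right (hW N (Nat.lt_succ_self N)) (geomBound_nonneg hu z))

lemma sum_geom_mul_eq {a : ℂ} (ha : a ≠ 1) (c : ℂ) (N : ℕ) (F : ℕ → ℂ) :
    ∑ v ∈ Finset.range N, F v * (∑ j ∈ Finset.range (v + 1), a ^ j) * c ^ v
      = (1 - a)⁻¹ * (∑ v ∈ Finset.range N, F v * c ^ v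
        - a * ∑ v ∈ Finset.range N, F v * (c * a) ^ v) := by
  have h1 : 1 - a ≠ 0 := sub_ne_zero.2 (Ne.symm ha)
  rw [Finset.mul_sum, ← Finset.sum_sub_distrib, Finset.mul_sum]
  refine Finset.sum_congr rfl fun v _ => ?_
  have h2 : ∑ j ∈ Finset.range (v + 1), a ^ j = (1 - a)⁻¹ * (1 - a ^ (v + 1)) := by
    rw [← mul_neg_geom_sum, inv_mul_cancel_left₀ h1]
  rw [h2, mul_pow, pow_succ]; ring

/-- For `a ≠ 1` the inner sum is `(1 - a)⁻¹ * (1 - a ^ (v + 1))`, which splits the sum into one with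
ratio `c` and one with ratio `c * a`. The factor 2 in `geomBound` is slack here. -/
lemma norm_sum_geom_mul_le {a c : ℂ} (ha : ‖a‖ = 1) (hne : a ≠ 1) (N : ℕ) (F : ℕ → ℂ) (u : ℝ)
    {X Y : ℝ} (hX : ‖∑ v ∈ Finset.range N, F v * c ^ v‖ ≤ X)
    (hY : ‖∑ v ∈ Finset.range N, F v * (c * a) ^ v‖ ≤ Y) :
    ‖∑ v ∈ Finset.range N, F v * (∑ j ∈ Finset.range (v + 1), a ^ j) * c ^ v‖
      ≤ geomBound u a * (X + Y) := by
  have hX0 := (norm_nonneg _).trans hX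
  have hY0 := (norm_nonneg _).trans hY
  rw [sum_geom_mul_eq hne, norm_mul, norm_inv, geomBound, if_neg hne]
  have : ‖∑ v ∈ Finset.range N, F v * c ^ v - a * ∑ v ∈ Finset.range N, F v * (c * a) ^ v‖
      ≤ X + Y := by
    refine (norm_sub_le _ _).trans ?_
    rw [norm_mul, ha, one_mul]; gcongr
  refine mul_le_mul ?_ this (norm_nonneg _) (by positivity)
  rw [div_eq_mul_inv]
  have : 0 ≤ ‖1 - a‖⁻¹ := by positivity
  linarith

/-- If `a = 1`, the inner sum is `v + 1 ≤ u`, so it merges with `w` into a new monotone weight, at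
the price `u = geomBound u 1`. Otherwise the geometric sum splits in two. -/
lemma norm_sum_weight_geom_le {u : ℝ} {a c : ℂ} (ha : ‖a‖ = 1) (hc : ‖c‖ = 1) {N : ℕ}
    (hN : (N : ℝ) ≤ u) {w : ℕ → ℝ} (hw : Monotone w) (h0 : 0 ≤ w 0) {W : ℝ}
    (hW : ∀ v < N, w v ≤ W) (hW0 : 0 ≤ W) :
    ‖∑ v ∈ Finset.range N, (w v : ℂ) * (∑ j ∈ Finset.range (v + 1), a ^ j) * c ^ v‖
      ≤ W * geomBound u a * (geomBound u c + geomBound u (c * a)) := by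
  have hu : 0 ≤ u := le_trans (Nat.cast_nonneg N) hN
  by_cases hne : a = 1
  · subst hne
    have h1 : ∀ v, ((w v : ℂ) * (∑ j ∈ Finset.range (v + 1), (1 : ℂ) ^ j) * c ^ v)
        = ((w v * (v + 1) : ℝ) : ℂ) * c ^ v := fun v => by simp
    simp only [h1]
    have hw0 : ∀ v, 0 ≤ w v := fun v => h0.trans (hw (Nat.zero_le v))
    refine (norm_sum_weight_mul_pow_le hc hN (w := fun v => w v * (v + 1)) (W := W * u)
      (fun a b h => ?_) (by simpa using h0) (fun v hv => ?_) (by positivity)).trans ?_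
    · have := hw0 a
      have := hw h
      have := hw0 b
      dsimp only
      gcongr
    · have : (v : ℝ) + 1 ≤ u := le_trans (by exact_mod_cast hv) hN
      exact mul_le_mul (hW v hv) this (by positivity) hW0
    · have := geomBound_nonneg hu c
      have h2 : geomBound u 1 = u := if_pos rfl
      rw [mul_one, h2]
      have : 0 ≤ W * u * geomBound u c := by positivity
      linarith
  · refine (norm_sum_geom_mul_le ha hne N _ u
      (norm_sum_weight_mul_pow_le hc hN hw h0 hW hW0)
      (norm_sum_weight_mul_pow_le (z := c * a) (by rw [norm_mul, ha, hc, one_mul])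
        hN hw h0 hW hW0)).trans_eq ?_
    ring

lemma norm_sum_geom_geom_le {u : ℝ} {a d c : ℂ} (ha : ‖a‖ = 1) (hd : ‖d‖ = 1) (hc : ‖c‖ = 1)
    {N : ℕ} (hN : (N : ℝ) ≤ u) :
    ‖∑ v ∈ Finset.range N, (∑ j ∈ Finset.range (v + 1), d ^ j) *
        (∑ j ∈ Finset.range (v + 1), a ^ j) * c ^ v‖
      ≤ geomBound u a * geomBound u d * (geomBound u c + geomBound u (c * a)
        + geomBound u (c * d) + geomBound u (c * a * d)) := by
  have hu : 0 ≤ u := le_trans (Nat.cast_nonneg N) hN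
  by_cases hne : a = 1
  · subst hne
    have h1 := norm_sum_weight_geom_le (w := fun v => (v : ℝ) + 1) (W := u) hd hc hN
      (fun a b h => by dsimp only; gcongr) (by simp)
      (fun v hv => le_trans (by exact_mod_cast hv) hN) hu
    have h2 : geomBound u 1 = u := if_pos rfl
    have h3 := geomBound_nonneg hu d
    have h4 := geomBound_nonneg hu c
    have h5 := geomBound_nonneg hu (c * d)
    refine (le_of_eq ?_).trans (h1.trans ?_)
    · congr 1
      refine Finset.sum_congr rfl fun v _ => ?_
      simp only [one_pow, Finset.sum_const, Finset.card_range, nsmul_eq_mul]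
      push_cast; ring
    · rw [h2, mul_one]
      refine mul_le_mul_of_nonneg_left ?_ (by positivity)
      linarith
  · have hF : ∀ e : ℂ, ‖e‖ = 1 → ‖∑ v ∈ Finset.range N,
        (∑ j ∈ Finset.range (v + 1), d ^ j) * e ^ v‖
        ≤ geomBound u d * (geomBound u e + geomBound u (e * d)) := fun e he => by
      have := norm_sum_weight_geom_le (w := fun _ => (1 : ℝ)) (W := 1) hd he hN
        monotone_const zero_le_one (fun _ _ => le_rfl) zero_le_one
      simpa using this
    refine (norm_sum_geom_mul_le ha hne N _ u (hF c hc)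
      (hF (c * a) (by rw [norm_mul, ha, hc, one_mul]))).trans_eq ?_
    ring

/-! ### Exponential sums over additive quadruples -/

/-- Quadruples of natural numbers below `t` with `j₁ + j₂ = j₃ + j₄`, subject to `p (j₁ + j₂)`. -/
def natEnergySet (t : ℕ) (p : ℕ → Prop) [DecidablePred p] : Finset (ℕ × ℕ × ℕ × ℕ) :=
  (Finset.range t ×ˢ Finset.range t ×ˢ Finset.range t ×ˢ Finset.range t).filter
    fun j => j.1 + j.2.1 = j.2.2.1 + j.2.2.2 ∧ p (j.1 + j.2.1)

lemma mem_natEnergySet {t : ℕ} {p : ℕ → Prop} [DecidablePred p] {j : ℕ × ℕ × ℕ × ℕ} :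
    j ∈ natEnergySet t p ↔ (j.1 < t ∧ j.2.1 < t ∧ j.2.2.1 < t ∧ j.2.2.2 < t) ∧
      j.1 + j.2.1 = j.2.2.1 + j.2.2.2 ∧ p (j.1 + j.2.1) := by
  simp [natEnergySet]

/-- The bound for exponential sums over additive quadruples. -/
noncomputable def quadBound (u : ℝ) (z₁ z₂ z₃ z₄ : ℂ) : ℝ :=
  geomBound u (z₂ * z₁⁻¹) * geomBound u (z₄ * z₃⁻¹) *
    (geomBound u (z₁ * z₃) + geomBound u (z₂ * z₃) + geomBound u (z₁ * z₄) + geomBound u (z₂ * z₄))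

lemma quadBound_inv (u : ℝ) {z₁ z₂ z₃ z₄ : ℂ} (h₁ : ‖z₁‖ = 1) (h₂ : ‖z₂‖ = 1) (h₃ : ‖z₃‖ = 1)
    (h₄ : ‖z₄‖ = 1) : quadBound u z₁⁻¹ z₂⁻¹ z₃⁻¹ z₄⁻¹ = quadBound u z₁ z₂ z₃ z₄ := by
  simp only [quadBound, ← mul_inv]
  rw [geomBound_inv, geomBound_inv, geomBound_inv, geomBound_inv, geomBound_inv, geomBound_inv] <;>
    simp [h₁, h₂, h₃, h₄]

/-- When `v = j₁ + j₂ < N ≤ t`, the constraints `jᵢ < t` hold automatically, so `j₂` and `j₄` range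
independently over `0, …, v`. The sum becomes a product of two inner geometric sums, summed over
`v`. -/
lemma norm_sum_natEnergySet_lt_le {t N : ℕ} (hN : N ≤ t) {z₁ z₂ z₃ z₄ : ℂ} (h₁ : ‖z₁‖ = 1)
    (h₂ : ‖z₂‖ = 1) (h₃ : ‖z₃‖ = 1) (h₄ : ‖z₄‖ = 1) :
    ‖∑ j ∈ natEnergySet t (· < N), z₁ ^ j.1 * z₂ ^ j.2.1 * z₃ ^ j.2.2.1 * z₄ ^ j.2.2.2‖
      ≤ quadBound t z₁ z₂ z₃ z₄ := by
  have hz₁ : z₁ ≠ 0 := by rintro rfl; simp at h₁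
  have hz₃ : z₃ ≠ 0 := by rintro rfl; simp at h₃
  have key : ∑ j ∈ natEnergySet t (· < N), z₁ ^ j.1 * z₂ ^ j.2.1 * z₃ ^ j.2.2.1 * z₄ ^ j.2.2.2
      = ∑ v ∈ Finset.range N, (∑ j ∈ Finset.range (v + 1), (z₄ * z₃⁻¹) ^ j) *
        (∑ j ∈ Finset.range (v + 1), (z₂ * z₁⁻¹) ^ j) * (z₁ * z₃) ^ v := by
    have e : ∀ v, (∑ j ∈ Finset.range (v + 1), (z₄ * z₃⁻¹) ^ j) *
        (∑ j ∈ Finset.range (v + 1), (z₂ * z₁⁻¹) ^ j) * (z₁ * z₃) ^ v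
        = ∑ x ∈ Finset.range (v + 1) ×ˢ Finset.range (v + 1),
          (z₄ * z₃⁻¹) ^ x.1 * (z₂ * z₁⁻¹) ^ x.2 * (z₁ * z₃) ^ v := fun v => by
      rw [Finset.sum_mul_sum, ← Finset.sum_product', Finset.sum_mul]
    simp only [e]
    rw [Finset.sum_sigma']
    refine Finset.sum_nbij' (fun j => ⟨j.1 + j.2.1, (j.2.2.2, j.2.1)⟩)
      (fun x => (x.1 - x.2.2, x.2.2, x.1 - x.2.1, x.2.1)) ?_ ?_ ?_ ?_ ?_
    · rintro ⟨a, b, c, d⟩ h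
      rw [mem_natEnergySet] at h
      simp only [Finset.mem_sigma, Finset.mem_range, Finset.mem_product] at h ⊢
      omega
    · rintro ⟨v, i, k⟩ h
      rw [mem_natEnergySet]
      simp only [Finset.mem_sigma, Finset.mem_range, Finset.mem_product] at h
      dsimp only at h ⊢
      omega
    · rintro ⟨a, b, c, d⟩ h
      rw [mem_natEnergySet] at h
      dsimp only at h ⊢
      simp only [Prod.mk.injEq, true_and, and_true]
      omega
    · rintro ⟨v, i, k⟩ h
      simp only [Finset.mem_sigma, Finset.mem_range, Finset.mem_product] at h
      have : v - k + k = v := by omega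
      simp [this]
    · rintro ⟨a, b, c, d⟩ h
      rw [mem_natEnergySet] at h
      dsimp only at h ⊢
      rw [mul_pow z₁ z₃, h.2.1, pow_add z₃, ← h.2.1, pow_add z₁, mul_pow, mul_pow, inv_pow, inv_pow]
      field_simp
  rw [key]
  have h := norm_sum_geom_geom_le (u := t) (a := z₂ * z₁⁻¹) (d := z₄ * z₃⁻¹) (c := z₁ * z₃)
    (by simp [h₁, h₂]) (by simp [h₃, h₄]) (by simp [h₁, h₃]) (N := N) (by exact_mod_cast hN)
  rw [show z₁ * z₃ * (z₂ * z₁⁻¹) = z₂ * z₃ by field_simp,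
    show z₁ * z₃ * (z₄ * z₃⁻¹) = z₁ * z₄ by field_simp,
    show z₂ * z₃ * (z₄ * z₃⁻¹) = z₂ * z₄ by field_simp] at h
  exact h

lemma norm_sum_natEnergySet_le (t : ℕ) {z₁ z₂ z₃ z₄ : ℂ} (h₁ : ‖z₁‖ = 1)
    (h₂ : ‖z₂‖ = 1) (h₃ : ‖z₃‖ = 1) (h₄ : ‖z₄‖ = 1) :
    ‖∑ j ∈ natEnergySet t (fun _ => True),
      z₁ ^ j.1 * z₂ ^ j.2.1 * z₃ ^ j.2.2.1 * z₄ ^ j.2.2.2‖ ≤ 2 * quadBound t z₁ z₂ z₃ z₄ := by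
  have hsplit : natEnergySet t (fun _ => True) = natEnergySet t (· < t) ∪ natEnergySet t (t ≤ ·) := by
    ext j
    simp only [Finset.mem_union, mem_natEnergySet, and_true]
    omega
  have hdisj : Disjoint (natEnergySet t (· < t)) (natEnergySet t (t ≤ ·)) := by
    rw [Finset.disjoint_left]
    intro j h h'
    rw [mem_natEnergySet] at h h'
    omega
  have hz : ∀ z : ℂ, ‖z‖ = 1 → z ≠ 0 := by rintro z h rfl; simp at h
  -- The reflection `j ↦ t - 1 - j` sends a sum `v ≥ t` to `2(t - 1) - v < t - 1`. It inverts the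
  -- ratios, which leaves `quadBound` unchanged.
  have hrefl : ∑ j ∈ natEnergySet t (t ≤ ·), z₁ ^ j.1 * z₂ ^ j.2.1 * z₃ ^ j.2.2.1 * z₄ ^ j.2.2.2
      = (z₁ * z₂ * z₃ * z₄) ^ (t - 1) * ∑ j ∈ natEnergySet t (· < t - 1),
        z₁⁻¹ ^ j.1 * z₂⁻¹ ^ j.2.1 * z₃⁻¹ ^ j.2.2.1 * z₄⁻¹ ^ j.2.2.2 := by
    rw [Finset.mul_sum]
    let φ : ℕ × ℕ × ℕ × ℕ → ℕ × ℕ × ℕ × ℕ := fun j =>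
      (t - 1 - j.1, t - 1 - j.2.1, t - 1 - j.2.2.1, t - 1 - j.2.2.2)
    refine Finset.sum_nbij' φ φ ?_ ?_ ?_ ?_ ?_
    · rintro ⟨a, b, c, d⟩ h
      rw [mem_natEnergySet] at h ⊢
      simp only [φ] at h ⊢
      omega
    · rintro ⟨a, b, c, d⟩ h
      rw [mem_natEnergySet] at h ⊢
      simp only [φ] at h ⊢
      omega
    · rintro ⟨a, b, c, d⟩ h
      rw [mem_natEnergySet] at h
      simp only [φ, Prod.mk.injEq] at h ⊢
      omega
    · rintro ⟨a, b, c, d⟩ h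
      rw [mem_natEnergySet] at h
      simp only [φ, Prod.mk.injEq] at h ⊢
      omega
    · rintro ⟨a, b, c, d⟩ h
      rw [mem_natEnergySet] at h
      dsimp only [φ] at h ⊢
      have e : ∀ (z : ℂ) (i : ℕ), ‖z‖ = 1 → i < t → z ^ i = z ^ (t - 1) * z⁻¹ ^ (t - 1 - i) :=
        fun z i hz1 hi => by
          have := hz z hz1
          rw [inv_pow, eq_mul_inv_iff_mul_eq₀ (pow_ne_zero _ this), ← pow_add]
          congr 1; omega
      rw [e z₁ a h₁ h.1.1, e z₂ b h₂ h.1.2.1, e z₃ c h₃ h.1.2.2.1, e z₄ d h₄ h.1.2.2.2]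
      simp only [mul_pow]; ring
  rw [hsplit, Finset.sum_union hdisj, hrefl]
  refine (norm_add_le _ _).trans ?_
  rw [norm_mul, norm_pow]
  simp only [norm_mul, h₁, h₂, h₃, h₄, mul_one, one_pow, one_mul]
  have e1 := norm_sum_natEnergySet_lt_le (le_refl t) h₁ h₂ h₃ h₄
  have e2 := norm_sum_natEnergySet_lt_le (Nat.sub_le t 1) (z₁ := z₁⁻¹) (z₂ := z₂⁻¹) (z₃ := z₃⁻¹)
    (z₄ := z₄⁻¹) (by simp [h₁]) (by simp [h₂]) (by simp [h₃]) (by simp [h₄])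
  rw [quadBound_inv _ h₁ h₂ h₃ h₄] at e2
  linarith

/-- Quadruples of integers in `[r, r + t)` with `x₁ + x₂ = x₃ + x₄`. -/
noncomputable def energySet (r : ℤ) (t : ℕ) : Finset (ℤ × ℤ × ℤ × ℤ) :=
  (Finset.Ico r (r + t) ×ˢ Finset.Ico r (r + t) ×ˢ Finset.Ico r (r + t) ×ˢ
    Finset.Ico r (r + t)).filter fun x => x.1 + x.2.1 = x.2.2.1 + x.2.2.2

lemma mem_energySet {r : ℤ} {t : ℕ} {x : ℤ × ℤ × ℤ × ℤ} :
    x ∈ energySet r t ↔ ((r ≤ x.1 ∧ x.1 < r + t) ∧ (r ≤ x.2.1 ∧ x.2.1 < r + t) ∧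
      (r ≤ x.2.2.1 ∧ x.2.2.1 < r + t) ∧ (r ≤ x.2.2.2 ∧ x.2.2.2 < r + t)) ∧
      x.1 + x.2.1 = x.2.2.1 + x.2.2.2 := by
  simp [energySet]

lemma norm_sum_energySet_le (r : ℤ) (t : ℕ) {z₁ z₂ z₃ z₄ : ℂ} (h₁ : ‖z₁‖ = 1)
    (h₂ : ‖z₂‖ = 1) (h₃ : ‖z₃‖ = 1) (h₄ : ‖z₄‖ = 1) :
    ‖∑ x ∈ energySet r t, z₁ ^ x.1 * z₂ ^ x.2.1 * z₃ ^ x.2.2.1 * z₄ ^ x.2.2.2‖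
      ≤ 2 * quadBound t z₁ z₂ z₃ z₄ := by
  have hz : ∀ z : ℂ, ‖z‖ = 1 → z ≠ 0 := by rintro z h rfl; simp at h
  have key : ∑ x ∈ energySet r t, z₁ ^ x.1 * z₂ ^ x.2.1 * z₃ ^ x.2.2.1 * z₄ ^ x.2.2.2
      = (z₁ * z₂ * z₃ * z₄) ^ r * ∑ j ∈ natEnergySet t (fun _ => True),
        z₁ ^ j.1 * z₂ ^ j.2.1 * z₃ ^ j.2.2.1 * z₄ ^ j.2.2.2 := by
    rw [Finset.mul_sum]
    refine Finset.sum_nbij'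
      (fun x => ((x.1 - r).toNat, (x.2.1 - r).toNat, (x.2.2.1 - r).toNat, (x.2.2.2 - r).toNat))
      (fun j => (r + j.1, r + j.2.1, r + j.2.2.1, r + j.2.2.2)) ?_ ?_ ?_ ?_ ?_
    · rintro ⟨a, b, c, d⟩ h
      rw [mem_energySet] at h
      simp only [mem_natEnergySet, and_true]
      dsimp only at h
      omega
    · rintro ⟨a, b, c, d⟩ h
      rw [mem_natEnergySet] at h
      rw [mem_energySet]
      dsimp only at h ⊢
      omega
    · rintro ⟨a, b, c, d⟩ h
      rw [mem_energySet] at h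
      simp only [Prod.mk.injEq] at h ⊢
      omega
    · rintro ⟨a, b, c, d⟩ h
      simp
    · rintro ⟨a, b, c, d⟩ h
      rw [mem_energySet] at h
      dsimp only at h ⊢
      have e : ∀ (z : ℂ) (i : ℤ), ‖z‖ = 1 → r ≤ i → z ^ i = z ^ r * z ^ (i - r).toNat :=
        fun z i hz1 hi => by
          rw [← zpow_natCast, ← zpow_add₀ (hz z hz1), Int.toNat_of_nonneg (by omega)]
          congr 1; omega
      rw [e z₁ a h₁ h.1.1.1, e z₂ b h₂ h.1.2.1.1, e z₃ c h₃ h.1.2.2.1.1, e z₄ d h₄ h.1.2.2.2.1]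
      simp only [mul_zpow]; ring
  rw [key, norm_mul, norm_zpow]
  simp only [norm_mul, h₁, h₂, h₃, h₄, mul_one, one_zpow, one_mul]
  exact norm_sum_natEnergySet_le t h₁ h₂ h₃ h₄

/-! ### Sums of the bound over roots of unity -/

/-- The distance from 1 to the root is `2 sin(π x / M)`, and Jordan's inequality bounds this below
by `4 w / M` with `w = min x (M - x)`. The sum of both reciprocals replaces `1 / w` so that no case
distinction survives in the statement. -/
lemma geomBound_exp_le (u : ℝ) {M x : ℕ} (hx : 0 < x) (hxM : x < M) :
    geomBound u (Complex.exp (2 * Real.pi * Complex.I / M) ^ x)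
      ≤ M / 2 * (1 / (x : ℝ) + 1 / ((M - x : ℕ) : ℝ)) := by
  have hM : (0 : ℝ) < M := by exact_mod_cast (by omega : 0 < M)
  have hx' : (0 : ℝ) < x := by exact_mod_cast hx
  have hy' : (0 : ℝ) < ((M - x : ℕ) : ℝ) := by exact_mod_cast (by omega : 0 < M - x)
  have hpi := Real.pi_pos
  have hsum : (x : ℝ) + ((M - x : ℕ) : ℝ) = M := by exact_mod_cast (by omega : x + (M - x) = M)
  set y : ℝ := ((M - x : ℕ) : ℝ) with hy
  have hnorm : ‖1 - Complex.exp (2 * Real.pi * Complex.I / M) ^ x‖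
      = 2 * Real.sin (Real.pi * x / M) := by
    rw [← Complex.exp_nat_mul, norm_sub_rev,
      show (x : ℂ) * (2 * Real.pi * Complex.I / M) = Complex.I * ((2 * Real.pi * x / M : ℝ) : ℂ) by
        push_cast; ring, Complex.norm_exp_I_mul_ofReal_sub_one,
      show 2 * Real.pi * x / M / 2 = Real.pi * x / M by ring, Real.norm_of_nonneg]
    have : 0 ≤ Real.sin (Real.pi * x / M) := by
      refine Real.sin_nonneg_of_nonneg_of_le_pi (by positivity) ?_
      rw [div_le_iff₀ hM]
      exact mul_le_mul_of_nonneg_left (by exact_mod_cast hxM.le) hpi.le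
    positivity
  have hlow : ∃ w : ℝ, 0 < w ∧ 2 * w / M ≤ Real.sin (Real.pi * x / M) ∧
      1 / w ≤ 1 / (x : ℝ) + 1 / y := by
    rcases le_total ((x : ℝ)) y with h | h
    · refine ⟨x, hx', ?_, by have : 0 < 1 / y := by positivity
                             linarith⟩
      refine le_trans (le_of_eq ?_) (Real.mul_le_sin (by positivity) ?_)
      · field_simp
      · rw [div_le_div_iff₀ hM two_pos]; nlinarith
    · refine ⟨y, hy', ?_, by have : 0 < 1 / (x : ℝ) := by positivity
                             linarith⟩
      rw [← Real.sin_pi_sub, show Real.pi - Real.pi * x / M = Real.pi * y / M by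
        rw [eq_div_iff hM.ne', sub_mul, div_mul_cancel₀ _ hM.ne', ← hsum]; ring]
      refine le_trans (le_of_eq ?_) (Real.mul_le_sin (by positivity) ?_)
      · field_simp
      · rw [div_le_div_iff₀ hM two_pos]; nlinarith
  obtain ⟨w, hw, hs, hle⟩ := hlow
  have hne : Complex.exp (2 * Real.pi * Complex.I / M) ^ x ≠ 1 := by
    intro h
    rw [h, sub_self, norm_zero] at hnorm
    have : 0 < 2 * w / M := by positivity
    linarith
  rw [geomBound, if_neg hne, hnorm]
  calc 2 / (2 * Real.sin (Real.pi * x / M)) ≤ 2 / (2 * (2 * w / M)) := by gcongr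
    _ = M / 2 * (1 / w) := by field_simp
    _ ≤ _ := by gcongr

lemma sum_geomBound_exp_le {u : ℝ} {M : ℕ} (hM : 0 < M) :
    ∑ x ∈ Finset.range M, geomBound u (Complex.exp (2 * Real.pi * Complex.I / M) ^ x)
      ≤ u + M * (1 + Real.log M) := by
  obtain ⟨m, rfl⟩ : ∃ m, M = m + 1 := ⟨M - 1, by omega⟩
  rw [Finset.sum_range_succ']
  have h1 : geomBound u (Complex.exp (2 * Real.pi * Complex.I / (m + 1 : ℕ)) ^ 0) = u := by
    simp [geomBound]
  have h2 : ∑ x ∈ Finset.range m, (1 / ((x + 1 : ℕ) : ℝ)) ≤ 1 + Real.log (m + 1 : ℕ) := by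
    have hh : ((harmonic m : ℚ) : ℝ) ≤ 1 + Real.log m := harmonic_le_one_add_log m
    have h3 : ((harmonic m : ℚ) : ℝ) = ∑ x ∈ Finset.range m, (1 / ((x + 1 : ℕ) : ℝ)) := by
      simp [harmonic]
    rw [← h3]
    refine hh.trans ?_
    rcases Nat.eq_zero_or_pos m with rfl | hm
    · simp
    · gcongr; omega
  have h3 : ∑ x ∈ Finset.range m, geomBound u
      (Complex.exp (2 * Real.pi * Complex.I / (m + 1 : ℕ)) ^ (x + 1))
      ≤ ∑ x ∈ Finset.range m, ((m + 1 : ℕ) : ℝ) / 2 *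
        (1 / ((x + 1 : ℕ) : ℝ) + 1 / ((m - 1 - x + 1 : ℕ) : ℝ)) := by
    refine Finset.sum_le_sum fun x hx => ?_
    have hx := Finset.mem_range.1 hx
    refine (geomBound_exp_le u (M := m + 1) (x := x + 1) (by omega) (by omega)).trans_eq ?_
    rw [show m + 1 - (x + 1) = m - 1 - x + 1 by omega]
  rw [← Finset.mul_sum, Finset.sum_add_distrib,
    Finset.sum_range_reflect (fun x => 1 / ((x + 1 : ℕ) : ℝ)) m] at h3
  rw [h1]
  have : (0 : ℝ) ≤ ((m + 1 : ℕ) : ℝ) := by positivity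
  nlinarith [mul_le_mul_of_nonneg_left h2 this]

lemma norm_stdAddChar {n : ℕ} [NeZero n] (a : ZMod n) : ‖ZMod.stdAddChar a‖ = 1 :=
  AddChar.norm_apply _ _

/-- The points `ζ * ZMod.stdAddChar a` are distinct `4n`-th roots of unity, so the sum is part of
the full sum over such roots. The twist `ζ` comes from the period-four signs. -/
lemma sum_geomBound_stdAddChar_le {u : ℝ} (hu : 0 ≤ u) (n : ℕ) [NeZero n] {ζ : ℂ} (hζ : ζ ^ 4 = 1) :
    ∑ a : ZMod n, geomBound u (ζ * ZMod.stdAddChar a)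
      ≤ u + (4 * n : ℕ) * (1 + Real.log (4 * n : ℕ)) := by
  classical
  have hn : 0 < n := Nat.pos_of_ne_zero (NeZero.ne n)
  have hM : 4 * n ≠ 0 := by omega
  have hζ0 : ζ ≠ 0 := by rintro rfl; norm_num at hζ
  have hω := Complex.isPrimitiveRoot_exp (4 * n) hM
  refine le_trans ?_ (sum_geomBound_exp_le (u := u) (M := 4 * n) (by omega))
  have hinj : Function.Injective fun a : ZMod n => ζ * ZMod.stdAddChar a := fun a b h =>
    ZMod.injective_stdAddChar (mul_left_cancel₀ hζ0 h)
  rw [← Finset.sum_image (g := fun a : ZMod n => ζ * ZMod.stdAddChar a) (f := geomBound u)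
    (hinj.injOn), ← Finset.sum_image
    (g := fun x : ℕ => Complex.exp (2 * Real.pi * Complex.I / (4 * n : ℕ)) ^ x) (f := geomBound u)]
  · refine Finset.sum_le_sum_of_subset_of_nonneg ?_ fun z _ _ => geomBound_nonneg hu z
    intro z hz
    obtain ⟨a, -, rfl⟩ := Finset.mem_image.1 hz
    have : NeZero (4 * n) := ⟨hM⟩
    obtain ⟨i, hi, h⟩ := hω.eq_pow_of_pow_eq_one (ξ := ζ * ZMod.stdAddChar a) (by
      rw [mul_pow, pow_mul, hζ, one_pow, one_mul, ← AddChar.map_nsmul_eq_pow]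
      simp)
    exact Finset.mem_image.2 ⟨i, Finset.mem_range.2 hi, h⟩
  · intro i hi j hj h
    exact hω.pow_inj (Finset.mem_range.1 hi) (Finset.mem_range.1 hj) h

/-! ### Averaging over the frequency shifts -/

section ErrorTerm

variable {G : Type*} [AddCommGroup G] [Fintype G]

/-- In each case the three arguments are independent linear forms in `a, b, c`, so the triple sum
factors. These are the combinations that occur in the four terms of `quadBound`. -/
lemma sum_shift_products (f g h : G → ℝ) :
    (∑ a, ∑ b, ∑ c, f (-a) * g (c - b) * h b = (∑ a, f a) * (∑ a, g a) * ∑ a, h a) ∧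
    (∑ a, ∑ b, ∑ c, f (-a) * g (c - b) * h (b - a) = (∑ a, f a) * (∑ a, g a) * ∑ a, h a) ∧
    (∑ a, ∑ b, ∑ c, f (-a) * g (c - b) * h c = (∑ a, f a) * (∑ a, g a) * ∑ a, h a) ∧
    (∑ a, ∑ b, ∑ c, f (-a) * g (c - b) * h (c - a) = (∑ a, f a) * (∑ a, g a) * ∑ a, h a) := by
  have h1 : ∀ (φ : G → ℝ) (b : G), ∑ c, φ (c - b) = ∑ c, φ c := fun φ b =>
    Equiv.sum_comp (Equiv.subRight b) φ
  have h2 : ∀ (φ : G → ℝ) (c : G), ∑ b, φ (c - b) = ∑ b, φ b := fun φ c =>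
    Equiv.sum_comp (Equiv.subLeft c) φ
  have h3 : ∀ (φ : G → ℝ), ∑ b, φ (-b) = ∑ b, φ b := fun φ => Equiv.sum_comp (Equiv.neg G) φ
  refine ⟨?_, ?_, ?_, ?_⟩
  · simp_rw [← Finset.sum_mul, ← Finset.mul_sum, h1, mul_assoc, ← Finset.mul_sum,
      ← Finset.sum_mul, h3]
  · simp_rw [← Finset.sum_mul, ← Finset.mul_sum, h1, ← Finset.mul_sum, h1,
      ← Finset.sum_mul, h3]
  · simp_rw [Finset.sum_comm (s := Finset.univ (α := G)) (t := Finset.univ (α := G))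
      (f := fun b c => f (-_) * g (c - b) * h c), ← Finset.sum_mul, ← Finset.mul_sum, h2,
      mul_assoc, ← Finset.mul_sum, ← Finset.sum_mul, h3]
  · simp_rw [Finset.sum_comm (s := Finset.univ (α := G)) (t := Finset.univ (α := G))
      (f := fun b c => f (-_) * g (c - b) * h (c - _)), ← Finset.sum_mul, ← Finset.mul_sum, h2,
      ← Finset.mul_sum, h1, ← Finset.sum_mul, h3]

end ErrorTerm

lemma sum_quadBound_le {n : ℕ} [NeZero n] {u Q : ℝ} (hu : 0 ≤ u)
    (hQ : ∀ ζ : ℂ, ζ ^ 4 = 1 → ∑ a : ZMod n, geomBound u (ζ * ZMod.stdAddChar a) ≤ Q)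
    {ζ₁ ζ₂ ζ₃ ζ₄ : ℂ} (h₁ : ζ₁ ^ 4 = 1) (h₂ : ζ₂ ^ 4 = 1) (h₃ : ζ₃ ^ 4 = 1) (h₄ : ζ₄ ^ 4 = 1) :
    ∑ a : ZMod n, ∑ b : ZMod n, ∑ c : ZMod n, quadBound u ζ₁ (ζ₂ * ZMod.stdAddChar (-a))
      (ζ₃ * ZMod.stdAddChar b) (ζ₄ * ZMod.stdAddChar c) ≤ 4 * Q ^ 3 := by
  let B : ℂ → ZMod n → ℝ := fun ζ a => geomBound u (ζ * ZMod.stdAddChar a)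
  have e : ∀ a b c : ZMod n, quadBound u ζ₁ (ζ₂ * ZMod.stdAddChar (-a))
      (ζ₃ * ZMod.stdAddChar b) (ζ₄ * ZMod.stdAddChar c)
      = B (ζ₂ * ζ₁⁻¹) (-a) * B (ζ₄ * ζ₃⁻¹) (c - b) * B (ζ₁ * ζ₃) b
        + B (ζ₂ * ζ₁⁻¹) (-a) * B (ζ₄ * ζ₃⁻¹) (c - b) * B (ζ₂ * ζ₃) (b - a)
        + B (ζ₂ * ζ₁⁻¹) (-a) * B (ζ₄ * ζ₃⁻¹) (c - b) * B (ζ₁ * ζ₄) c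
        + B (ζ₂ * ζ₁⁻¹) (-a) * B (ζ₄ * ζ₃⁻¹) (c - b) * B (ζ₂ * ζ₄) (c - a) := by
    intro a b c
    simp only [quadBound, B, sub_eq_add_neg, AddChar.map_add_eq_mul, AddChar.map_neg_eq_inv, mul_inv]
    rw [show ζ₂ * (ZMod.stdAddChar a)⁻¹ * ζ₁⁻¹ = ζ₂ * ζ₁⁻¹ * (ZMod.stdAddChar a)⁻¹ by ring,
      show ζ₄ * ZMod.stdAddChar c * (ζ₃⁻¹ * (ZMod.stdAddChar b)⁻¹)
        = ζ₄ * ζ₃⁻¹ * (ZMod.stdAddChar c * (ZMod.stdAddChar b)⁻¹) by ring,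
      show ζ₁ * (ζ₃ * ZMod.stdAddChar b) = ζ₁ * ζ₃ * ZMod.stdAddChar b by ring,
      show ζ₁ * (ζ₄ * ZMod.stdAddChar c) = ζ₁ * ζ₄ * ZMod.stdAddChar c by ring,
      show ζ₂ * (ZMod.stdAddChar a)⁻¹ * (ζ₃ * ZMod.stdAddChar b)
        = ζ₂ * ζ₃ * (ZMod.stdAddChar b * (ZMod.stdAddChar a)⁻¹) by ring,
      show ζ₂ * (ZMod.stdAddChar a)⁻¹ * (ζ₄ * ZMod.stdAddChar c)
        = ζ₂ * ζ₄ * (ZMod.stdAddChar c * (ZMod.stdAddChar a)⁻¹) by ring]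
    ring
  have hB0 : ∀ ζ, 0 ≤ ∑ a, B ζ a := fun ζ => Finset.sum_nonneg fun a _ => geomBound_nonneg hu _
  have hprod : ∀ x y z : ℂ, x ^ 4 = 1 → y ^ 4 = 1 → z ^ 4 = 1 →
      (∑ a, B x a) * (∑ a, B y a) * (∑ a, B z a) ≤ Q ^ 3 := fun x y z hx hy hz => by
    have hQ0 : 0 ≤ Q := (hB0 x).trans (hQ x hx)
    calc _ ≤ Q * Q * Q := mul_le_mul (mul_le_mul (hQ x hx) (hQ y hy) (hB0 y) hQ0) (hQ z hz)
          (hB0 z) (by positivity)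
      _ = Q ^ 3 := by ring
  simp only [e, Finset.sum_add_distrib]
  have p21 : (ζ₂ * ζ₁⁻¹) ^ 4 = 1 := by rw [mul_pow, inv_pow, h₁, h₂]; norm_num
  have p43 : (ζ₄ * ζ₃⁻¹) ^ 4 = 1 := by rw [mul_pow, inv_pow, h₃, h₄]; norm_num
  have q1 := hprod _ _ (ζ₁ * ζ₃) p21 p43 (by rw [mul_pow, h₁, h₃, one_mul])
  have q2 := hprod _ _ (ζ₂ * ζ₃) p21 p43 (by rw [mul_pow, h₂, h₃, one_mul])
  have q3 := hprod _ _ (ζ₁ * ζ₄) p21 p43 (by rw [mul_pow, h₁, h₄, one_mul])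
  have q4 := hprod _ _ (ζ₂ * ζ₄) p21 p43 (by rw [mul_pow, h₂, h₄, one_mul])
  rw [(sum_shift_products _ _ (B (ζ₁ * ζ₃))).1, (sum_shift_products _ _ (B (ζ₂ * ζ₃))).2.1,
    (sum_shift_products _ _ (B (ζ₁ * ζ₄))).2.2.1, (sum_shift_products _ _ (B (ζ₂ * ζ₄))).2.2.2]
  linarith

/-- The weight of a quadruple with respect to a sign pattern of period four. -/
def quadWeight (σ : ZMod 4 → ℤ) (x : ℤ × ℤ × ℤ × ℤ) : ℤ := σ x.1 * σ x.2.1 * σ x.2.2.1 * σ x.2.2.2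

/-- The phase that goes with `spectralL A a b c`. -/
noncomputable def quadPhase {n : ℕ} [NeZero n] (a b c : ZMod n) (x : ℤ × ℤ × ℤ × ℤ) : ℂ :=
  ZMod.stdAddChar (-a * (x.2.1 : ZMod n) + b * (x.2.2.1 : ZMod n) + c * (x.2.2.2 : ZMod n))

/-- Fourier inversion on `ZMod 4`: the signs become combinations of powers of fourth roots of unity,
to which the exponential sum bounds apply. -/
lemma exists_fourier_expansion (σ : ZMod 4 → ℤ) (hσ : ∀ y, |σ y| = 1) :
    ∃ s : ZMod 4 → ℂ, (∀ y, ‖s y‖ ≤ 1) ∧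
      ∀ x : ℤ, (σ x : ℂ) = ∑ y, s y * (ZMod.stdAddChar y : ℂ) ^ x := by
  refine ⟨fun y => 1 / 4 * ∑ z, (σ z : ℂ) * ZMod.stdAddChar (y * -z), fun y => ?_, fun x => ?_⟩
  · rw [norm_mul]
    have : ‖∑ z, (σ z : ℂ) * ZMod.stdAddChar (y * -z)‖ ≤ ∑ z : ZMod 4, (1 : ℝ) := by
      refine norm_sum_le_of_le _ fun z _ => ?_
      rw [norm_mul, norm_stdAddChar, mul_one, Complex.norm_intCast]
      exact_mod_cast (hσ z).le
    rw [Finset.sum_const, Finset.card_univ, ZMod.card] at this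
    norm_num at this ⊢
    linarith
  · have h : ∀ y : ZMod 4, (1 / 4 * ∑ z, (σ z : ℂ) * ZMod.stdAddChar (y * -z)) *
        (ZMod.stdAddChar y : ℂ) ^ x = 1 / 4 * ∑ z, (σ z : ℂ) * ZMod.stdAddChar (y * ((x : ZMod 4) - z)) := by
      intro y
      rw [mul_assoc, Finset.sum_mul]
      congr 1
      refine Finset.sum_congr rfl fun z _ => ?_
      rw [mul_assoc, ← AddChar.map_zsmul_eq_zpow, ← AddChar.map_add_eq_mul]
      congr 2
      rw [zsmul_eq_mul]; ring
    simp only [h]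
    rw [← Finset.mul_sum, Finset.sum_comm]
    simp only [← Finset.mul_sum]
    simp only [AddChar.sum_mulShift _ (ZMod.isPrimitive_stdAddChar 4), sub_eq_zero, ZMod.card]
    simp
    ring

lemma sum_mul_sum_four {ι : Type*} [Fintype ι] (f g h k : ι → ℂ) :
    (∑ y, f y) * (∑ y, g y) * (∑ y, h y) * ∑ y, k y
      = ∑ y : ι × ι × ι × ι, f y.1 * g y.2.1 * h y.2.2.1 * k y.2.2.2 := by
  simp only [Fintype.sum_prod_type, ← Finset.mul_sum, ← Finset.sum_mul]

lemma sum_reverse_three {ι R : Type*} [Fintype ι] [AddCommMonoid R] (f : ι → ι → ι → R) :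
    ∑ a, ∑ b, ∑ c, f a b c = ∑ c, ∑ b, ∑ a, f a b c := by
  rw [Finset.sum_comm, Finset.sum_congr rfl fun _ _ => Finset.sum_comm, Finset.sum_comm]

lemma sum_comm_three {ι κ : Type*} [Fintype ι] [Fintype κ] {R : Type*} [AddCommMonoid R]
    (f : ι → ι → ι → κ → R) :
    ∑ a, ∑ b, ∑ c, ∑ y, f a b c y = ∑ y, ∑ a, ∑ b, ∑ c, f a b c y := by
  calc _ = ∑ a, ∑ b, ∑ y, ∑ c, f a b c y := Finset.sum_congr rfl fun a _ =>
        Finset.sum_congr rfl fun b _ => Finset.sum_comm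
    _ = ∑ a, ∑ y, ∑ b, ∑ c, f a b c y := Finset.sum_congr rfl fun a _ => Finset.sum_comm
    _ = _ := Finset.sum_comm

lemma sum_norm_twisted_le {n : ℕ} [NeZero n] {σ : ZMod 4 → ℤ} (hσ : ∀ y, |σ y| = 1)
    (r : ℤ) (t : ℕ) {Q : ℝ}
    (hQ : ∀ ζ : ℂ, ζ ^ 4 = 1 → ∑ a : ZMod n, geomBound t (ζ * ZMod.stdAddChar a) ≤ Q) :
    ∑ a : ZMod n, ∑ b : ZMod n, ∑ c : ZMod n,
      ‖∑ x ∈ energySet r t, (quadWeight σ x : ℂ) * quadPhase a b c x‖ ≤ 2048 * Q ^ 3 := by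
  obtain ⟨s, hs, hsσ⟩ := exists_fourier_expansion σ hσ
  let ψ : ZMod 4 → ℂ := fun y => ZMod.stdAddChar y
  have hψ : ∀ y, ‖ψ y‖ = 1 := fun y => norm_stdAddChar y
  have hψ4 : ∀ y, ψ y ^ 4 = 1 := fun y => by
    simp only [ψ]
    rw [← AddChar.map_nsmul_eq_pow, nsmul_eq_mul, show ((4 : ℕ) : ZMod 4) = 0 from rfl, zero_mul,
      AddChar.map_zero_eq_one]
  have hbound : ∀ a b c : ZMod n,
      ‖∑ x ∈ energySet r t, (quadWeight σ x : ℂ) * quadPhase a b c x‖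
      ≤ ∑ y : ZMod 4 × ZMod 4 × ZMod 4 × ZMod 4, 2 * quadBound t (ψ y.1)
        (ψ y.2.1 * ZMod.stdAddChar (-a)) (ψ y.2.2.1 * ZMod.stdAddChar b)
        (ψ y.2.2.2 * ZMod.stdAddChar c) := by
    intro a b c
    have hx : ∀ x : ℤ × ℤ × ℤ × ℤ, (quadWeight σ x : ℂ) * quadPhase a b c x
        = ∑ y : ZMod 4 × ZMod 4 × ZMod 4 × ZMod 4, s y.1 * s y.2.1 * s y.2.2.1 * s y.2.2.2 *
          (ψ y.1 ^ x.1 * (ψ y.2.1 * ZMod.stdAddChar (-a)) ^ x.2.1 *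
          (ψ y.2.2.1 * ZMod.stdAddChar b) ^ x.2.2.1 *
          (ψ y.2.2.2 * ZMod.stdAddChar c) ^ x.2.2.2) := by
      intro x
      have hp : quadPhase a b c x = (ZMod.stdAddChar (-a) : ℂ) ^ x.2.1 *
          (ZMod.stdAddChar b : ℂ) ^ x.2.2.1 * (ZMod.stdAddChar c : ℂ) ^ x.2.2.2 := by
        simp only [quadPhase, AddChar.map_add_eq_mul, ← AddChar.map_zsmul_eq_zpow, zsmul_eq_mul,
          mul_comm]
      rw [hp, quadWeight]
      push_cast
      rw [hsσ, hsσ, hsσ, hsσ]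
      rw [sum_mul_sum_four, Finset.sum_mul]
      refine Finset.sum_congr rfl fun y _ => ?_
      simp only [mul_zpow, ψ]
      ring
    simp only [hx]
    rw [Finset.sum_comm]
    refine norm_sum_le_of_le _ fun y _ => ?_
    rw [← Finset.mul_sum, norm_mul]
    have h1 : ‖s y.1 * s y.2.1 * s y.2.2.1 * s y.2.2.2‖ ≤ 1 := by
      simp only [norm_mul]
      have := hs y.1; have := hs y.2.1; have := hs y.2.2.1; have := hs y.2.2.2
      refine mul_le_one₀ (mul_le_one₀ (mul_le_one₀ ?_ ?_ ?_) ?_ ?_) ?_ ?_ <;>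
        first | assumption | positivity
    have h2 := norm_sum_energySet_le r t (z₁ := ψ y.1) (z₂ := ψ y.2.1 * ZMod.stdAddChar (-a))
      (z₃ := ψ y.2.2.1 * ZMod.stdAddChar b) (z₄ := ψ y.2.2.2 * ZMod.stdAddChar c) (hψ _)
      (by simp [hψ]) (by simp [hψ])
      (by simp [hψ])
    exact (mul_le_of_le_one_left (norm_nonneg _) h1).trans h2
  calc _ ≤ ∑ a : ZMod n, ∑ b : ZMod n, ∑ c : ZMod n,
        ∑ y : ZMod 4 × ZMod 4 × ZMod 4 × ZMod 4, 2 * quadBound t (ψ y.1)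
        (ψ y.2.1 * ZMod.stdAddChar (-a)) (ψ y.2.2.1 * ZMod.stdAddChar b)
        (ψ y.2.2.2 * ZMod.stdAddChar c) :=
        Finset.sum_le_sum fun a _ => Finset.sum_le_sum fun b _ =>
          Finset.sum_le_sum fun c _ => hbound a b c
    _ = ∑ y : ZMod 4 × ZMod 4 × ZMod 4 × ZMod 4, 2 * ∑ a : ZMod n, ∑ b : ZMod n, ∑ c : ZMod n,
        quadBound t (ψ y.1) (ψ y.2.1 * ZMod.stdAddChar (-a)) (ψ y.2.2.1 * ZMod.stdAddChar b)
        (ψ y.2.2.2 * ZMod.stdAddChar c) := by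
        simp only [Finset.mul_sum]
        exact sum_comm_three _
    _ ≤ ∑ y : ZMod 4 × ZMod 4 × ZMod 4 × ZMod 4, 2 * (4 * Q ^ 3) :=
        Finset.sum_le_sum fun y _ => mul_le_mul_of_nonneg_left
          (sum_quadBound_le (Nat.cast_nonneg t) hQ (hψ4 _) (hψ4 _) (hψ4 _) (hψ4 _)) two_pos.le
    _ = 2048 * Q ^ 3 := by
        -- The constant is `4 ^ 4 * 2 * 4`: the choices of four characters, the two halves of the
        -- energy set, and the four terms of `quadBound`.
        rw [Finset.sum_const, Finset.card_univ]
        simp only [Fintype.card_prod, ZMod.card, nsmul_eq_mul]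
        norm_num; ring

/-! ### Fourier expansion of products of four entries -/

namespace BinarySeq

variable {n : ℕ} [NeZero n]

lemma periodicExt_eq_inverse_transform (A : BinarySeq n) (x : ℤ) :
    ((periodicExt A x : ℤ) : ℂ)
      = 1 / n * ∑ k : ZMod n, A.polyEval (ZMod.stdAddChar k) * ZMod.stdAddChar (-(k * (x : ZMod n))) := by
  have hn : (n : ℂ) ≠ 0 := Nat.cast_ne_zero.2 (NeZero.ne n)
  have hn' : (0 : ℤ) < n := by exact_mod_cast Nat.pos_of_ne_zero (NeZero.ne n)
  have h : ∀ k : ZMod n, A.polyEval (ZMod.stdAddChar k) * ZMod.stdAddChar (-(k * (x : ZMod n)))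
      = ∑ j : Fin n, ((A j : ℤ) : ℂ) * ZMod.stdAddChar (k * (((j : ℕ) : ZMod n) - (x : ZMod n))) := by
    intro k
    rw [polyEval, Finset.sum_mul]
    refine Finset.sum_congr rfl fun j _ => ?_
    rw [mul_assoc, ← AddChar.map_nsmul_eq_pow, ← AddChar.map_add_eq_mul, nsmul_eq_mul]
    congr 2; ring
  simp only [h]
  rw [Finset.sum_comm]
  simp only [← Finset.mul_sum, AddChar.sum_mulShift _ (ZMod.isPrimitive_stdAddChar n), ZMod.card,
    sub_eq_zero]
  have h1 := Int.emod_nonneg x hn'.ne'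
  have h2 := Int.emod_lt_of_pos x hn'
  rw [Finset.sum_eq_single (⟨(x % (n : ℤ)).toNat, by omega⟩ : Fin n)]
  · rw [if_pos]
    · rw [periodicExt]; field_simp
    · have : (((x % (n : ℤ)).toNat : ℤ) : ZMod n) = (x : ZMod n) := by
        rw [Int.toNat_of_nonneg h1, ZMod.intCast_mod]
      rwa [Int.cast_natCast] at this
  · intro j _ hj
    rw [if_neg]; · simp
    intro hjx
    apply hj
    have : ((j : ℕ) : ℤ) % n = x % n := by
      rw [← ZMod.intCast_eq_intCast_iff']; simpa using hjx
    have hj2 : ((j : ℕ) : ℤ) % n = (j : ℕ) :=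
      Int.emod_eq_of_lt (by positivity) (by exact_mod_cast j.isLt)
    ext
    simp only
    omega
  · simp

lemma periodicExt_eq_shifted_transform (A : BinarySeq n) (x : ℤ) (k : ZMod n) :
    ((periodicExt A x : ℤ) : ℂ) = 1 / n * ∑ a : ZMod n,
      A.polyEval (ZMod.stdAddChar (k + a)) * ZMod.stdAddChar (-((k + a) * (x : ZMod n))) := by
  rw [periodicExt_eq_inverse_transform]
  congr 1
  exact (Equiv.sum_comp (Equiv.addLeft k) fun a : ZMod n =>
    A.polyEval (ZMod.stdAddChar a) * ZMod.stdAddChar (-(a * (x : ZMod n)))).symm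

lemma periodicExt_eq_conj_transform (A : BinarySeq n) (x : ℤ) (k : ZMod n) :
    ((periodicExt A x : ℤ) : ℂ) = 1 / n * ∑ a : ZMod n,
      (starRingEnd ℂ) (A.polyEval (ZMod.stdAddChar (k + a))) *
        ZMod.stdAddChar ((k + a) * (x : ZMod n)) := by
  have h := congrArg (starRingEnd ℂ) (periodicExt_eq_shifted_transform A x k)
  rw [map_intCast] at h
  rw [h]
  simp only [map_mul, map_sum, map_div₀, map_one, Complex.conj_natCast]
  congr 1
  refine Finset.sum_congr rfl fun a _ => ?_
  rw [← AddChar.map_neg_eq_conj, neg_neg]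

/-- The first entry is expanded with frequency `k`, the other three with frequencies measured from
`k`, the last two after conjugation (the entries are real). The additive relation removes `k` from
the phase, so the sum over `k` produces `spectralL`. -/
lemma periodicExt_quadruple (A : BinarySeq n) {x : ℤ × ℤ × ℤ × ℤ}
    (hx : x.1 + x.2.1 = x.2.2.1 + x.2.2.2) :
    ((periodicExt A x.1 : ℤ) : ℂ) * (periodicExt A x.2.1 : ℤ) * (periodicExt A x.2.2.1 : ℤ) *
      (periodicExt A x.2.2.2 : ℤ)
      = 1 / n * ∑ a : ZMod n, ∑ b : ZMod n, ∑ c : ZMod n, spectralL A a b c * quadPhase a b c x := by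
  have hn : (n : ℂ) ≠ 0 := Nat.cast_ne_zero.2 (NeZero.ne n)
  rw [periodicExt_eq_inverse_transform A x.1, Finset.mul_sum, Finset.sum_mul, Finset.sum_mul,
    Finset.sum_mul]
  have h : ∀ k : ZMod n, 1 / (n : ℂ) * (A.polyEval (ZMod.stdAddChar k) *
      ZMod.stdAddChar (-(k * (x.1 : ZMod n)))) * ((periodicExt A x.2.1 : ℤ) : ℂ) *
      (periodicExt A x.2.2.1 : ℤ) * (periodicExt A x.2.2.2 : ℤ)
      = ∑ a : ZMod n, ∑ b : ZMod n, ∑ c : ZMod n, 1 / (n : ℂ) * (1 / (n : ℂ) ^ 3 *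
        (A.polyEval (ZMod.stdAddChar k) * A.polyEval (ZMod.stdAddChar (k + a)) *
        (starRingEnd ℂ) (A.polyEval (ZMod.stdAddChar (k + b))) *
        (starRingEnd ℂ) (A.polyEval (ZMod.stdAddChar (k + c)))) * quadPhase a b c x) := by
    intro k
    rw [periodicExt_eq_shifted_transform A x.2.1 k, periodicExt_eq_conj_transform A x.2.2.1 k,
      periodicExt_eq_conj_transform A x.2.2.2 k]
    simp only [Finset.sum_mul, Finset.mul_sum]
    rw [sum_reverse_three]
    refine Finset.sum_congr rfl fun a _ => Finset.sum_congr rfl fun b _ =>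
      Finset.sum_congr rfl fun c _ => ?_
    have hp : quadPhase a b c x = ZMod.stdAddChar (-(k * (x.1 : ZMod n))) *
        ZMod.stdAddChar (-((k + a) * (x.2.1 : ZMod n))) *
        ZMod.stdAddChar ((k + b) * (x.2.2.1 : ZMod n)) *
        ZMod.stdAddChar ((k + c) * (x.2.2.2 : ZMod n)) := by
      simp only [quadPhase, ← AddChar.map_add_eq_mul]
      congr 1
      have : (x.1 : ZMod n) + x.2.1 = x.2.2.1 + x.2.2.2 := by exact_mod_cast congrArg _ hx
      linear_combination k * this
    rw [hp]
    field_simp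
  simp only [h]
  simp only [spectralL, Finset.mul_sum, Finset.sum_mul]
  exact (sum_comm_three _).symm

end BinarySeq

/-! ### Main term and error of the energy -/

lemma sum_stdAddChar_mul {n : ℕ} [NeZero n] (b : ZMod n) :
    (1 / n : ℂ) * ∑ a : ZMod n, ZMod.stdAddChar (a * b) = if b = 0 then 1 else 0 := by
  have hn : (n : ℂ) ≠ 0 := Nat.cast_ne_zero.2 (NeZero.ne n)
  rw [AddChar.sum_mulShift _ (ZMod.isPrimitive_stdAddChar n), ZMod.card]
  split_ifs
  · field_simp
  · simp

lemma sum_indicatorI_mul_quadPhase {n : ℕ} [NeZero n] (x : ℤ × ℤ × ℤ × ℤ) :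
    1 / (n : ℂ) * ∑ a : ZMod n, ∑ b : ZMod n, ∑ c : ZMod n, indicatorI a b c * quadPhase a b c x
      = (if (n : ℤ) ∣ x.2.2.2 - x.2.1 then 1 else 0) + (if (n : ℤ) ∣ x.2.2.1 - x.2.1 then 1 else 0)
        + (if (n : ℤ) ∣ x.2.2.1 + x.2.2.2 then 1 else 0) - 2 / n := by
  classical
  -- Any two of the three conditions hold together only at the origin. There the three indicators
  -- add to 3 instead of 1, hence the correction by 2.
  have hI : ∀ a b c : ZMod n, indicatorI a b c
      = (if a = 0 then if b = c then 1 else 0 else 0) + (if b = 0 then if a = c then 1 else 0 else 0)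
        + (if c = 0 then if a = b then 1 else 0 else 0)
        - 2 * (if a = 0 then if b = 0 then if c = 0 then 1 else 0 else 0 else 0) := by
    intro a b c
    unfold indicatorI
    by_cases ha : a = 0 <;> by_cases hb : b = 0 <;> by_cases hc : c = 0 <;>
      simp [ha, hb, hc] <;> grind
  have hd : ∀ y : ℤ, (n : ℤ) ∣ y ↔ (y : ZMod n) = 0 := fun y =>
    (ZMod.intCast_zmod_eq_zero_iff_dvd y n).symm
  have s1 : ∀ F : ZMod n → ZMod n → ZMod n → ℂ, ∑ a, ∑ b, ∑ c,
      (if a = 0 then if b = c then 1 else 0 else 0) * F a b c = ∑ b, F 0 b b := fun F => by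
    rw [Finset.sum_eq_single 0 (fun a _ ha => by simp [ha]) (by simp)]
    simp
  have s2 : ∀ F : ZMod n → ZMod n → ZMod n → ℂ, ∑ a, ∑ b, ∑ c,
      (if b = 0 then if a = c then 1 else 0 else 0) * F a b c = ∑ b, F b 0 b := fun F => by
    refine Finset.sum_congr rfl fun a _ => ?_
    rw [Finset.sum_eq_single 0 (fun a _ ha => by simp [ha]) (by simp)]
    simp
  have s3 : ∀ F : ZMod n → ZMod n → ZMod n → ℂ, ∑ a, ∑ b, ∑ c,
      (if c = 0 then if a = b then 1 else 0 else 0) * F a b c = ∑ b, F b b 0 := fun F => by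
    simp
  have s4 : ∀ F : ZMod n → ZMod n → ZMod n → ℂ, ∑ a, ∑ b, ∑ c,
      2 * (if a = 0 then if b = 0 then if c = 0 then 1 else 0 else 0 else 0) * F a b c
      = 2 * F 0 0 0 := fun F => by
    rw [Finset.sum_eq_single 0 (fun a _ ha => by simp [ha]) (by simp),
      Finset.sum_eq_single 0 (fun a _ ha => by simp [ha]) (by simp)]
    simp
  simp only [hI, sub_mul, add_mul, Finset.sum_sub_distrib, Finset.sum_add_distrib]
  rw [s1, s2, s3, s4, mul_sub, mul_add, mul_add, show quadPhase (0 : ZMod n) 0 0 x = 1 by simp [quadPhase]]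
  have p1 : ∀ b : ZMod n, quadPhase 0 b b x
      = ZMod.stdAddChar (b * ((x.2.2.1 + x.2.2.2 : ℤ) : ZMod n)) := fun b => by
    rw [quadPhase]; congr 1; push_cast; ring
  have p2 : ∀ b : ZMod n, quadPhase b 0 b x
      = ZMod.stdAddChar (b * ((x.2.2.2 - x.2.1 : ℤ) : ZMod n)) := fun b => by
    rw [quadPhase]; congr 1; push_cast; ring
  have p3 : ∀ b : ZMod n, quadPhase b b 0 x
      = ZMod.stdAddChar (b * ((x.2.2.1 - x.2.1 : ℤ) : ZMod n)) := fun b => by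
    rw [quadPhase]; congr 1; push_cast; ring
  simp only [p1, p2, p3, sum_stdAddChar_mul, hd]
  ring

/-- The sum of the weights of the quadruples that satisfy `P`. -/
noncomputable def weightedCount (σ : ZMod 4 → ℤ) (r : ℤ) (t : ℕ) (P : ℤ × ℤ × ℤ × ℤ → Prop) : ℤ :=
  open Classical in ∑ x ∈ (energySet r t).filter P, quadWeight σ x

lemma norm_spectralL_sub_indicatorI_le {n : ℕ} [NeZero n] (A : BinarySeq n) (a b c : ZMod n) :
    ‖A.spectralL a b c - indicatorI a b c‖ ≤ maxDeviation A :=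
  le_ciSup (f := fun x : ZMod n × ZMod n × ZMod n =>
    ‖A.spectralL x.1 x.2.1 x.2.2 - indicatorI x.1 x.2.1 x.2.2‖) (Set.finite_range _).bddAbove (a, b, c)

/-- The energy of the sequence `σ(x) a_x` on the interval `[r, r + t)`. -/
noncomputable def signedEnergy {n : ℕ} [NeZero n] (A : BinarySeq n) (σ : ZMod 4 → ℤ) (r : ℤ) (t : ℕ) : ℤ :=
  ∑ x ∈ energySet r t, quadWeight σ x * ((A.periodicExt x.1 : ℤ) * (A.periodicExt x.2.1 : ℤ) *
    (A.periodicExt x.2.2.1 : ℤ) * (A.periodicExt x.2.2.2 : ℤ))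

/-- Splitting `L = I + (L - I)` in the Fourier expansion: the `I` part is evaluated exactly, and the
rest is the maximal deviation times the averaged exponential sums. -/
lemma abs_signedEnergy_sub_le {n : ℕ} [NeZero n] (A : BinarySeq n) {σ : ZMod 4 → ℤ}
    (hσ : ∀ y, |σ y| = 1) (r : ℤ) (t : ℕ) {Q : ℝ}
    (hQ : ∀ ζ : ℂ, ζ ^ 4 = 1 → ∑ a : ZMod n, geomBound t (ζ * ZMod.stdAddChar a) ≤ Q) :
    |(signedEnergy A σ r t : ℝ) - (weightedCount σ r t (fun x => (n : ℤ) ∣ x.2.2.2 - x.2.1)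
        + weightedCount σ r t (fun x => (n : ℤ) ∣ x.2.2.1 - x.2.1)
        + weightedCount σ r t (fun x => (n : ℤ) ∣ x.2.2.1 + x.2.2.2)
        - 2 / n * weightedCount σ r t (fun _ => True))|
      ≤ 1 / n * (maxDeviation A * (2048 * Q ^ 3)) := by
  classical
  have hmain : ((signedEnergy A σ r t : ℤ) : ℂ)
      = (weightedCount σ r t (fun x => (n : ℤ) ∣ x.2.2.2 - x.2.1)
        + weightedCount σ r t (fun x => (n : ℤ) ∣ x.2.2.1 - x.2.1)
        + weightedCount σ r t (fun x => (n : ℤ) ∣ x.2.2.1 + x.2.2.2)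
        - 2 / n * weightedCount σ r t (fun _ => True))
        + 1 / n * ∑ a : ZMod n, ∑ b : ZMod n, ∑ c : ZMod n,
          (A.spectralL a b c - indicatorI a b c) *
            ∑ x ∈ energySet r t, (quadWeight σ x : ℂ) * quadPhase a b c x := by
    have h1 : ∀ x ∈ energySet r t, ((quadWeight σ x * ((A.periodicExt x.1 : ℤ) *
        (A.periodicExt x.2.1 : ℤ) * (A.periodicExt x.2.2.1 : ℤ) * (A.periodicExt x.2.2.2 : ℤ)) : ℤ) : ℂ)
        = quadWeight σ x * ((if (n : ℤ) ∣ x.2.2.2 - x.2.1 then 1 else 0)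
          + (if (n : ℤ) ∣ x.2.2.1 - x.2.1 then 1 else 0)
          + (if (n : ℤ) ∣ x.2.2.1 + x.2.2.2 then 1 else 0) - 2 / n)
          + ∑ a : ZMod n, ∑ b : ZMod n, ∑ c : ZMod n, 1 / n * ((A.spectralL a b c - indicatorI a b c) *
            ((quadWeight σ x : ℂ) * quadPhase a b c x)) := by
      intro x hx
      rw [mem_energySet] at hx
      push_cast
      rw [A.periodicExt_quadruple hx.2, ← sum_indicatorI_mul_quadPhase]
      simp only [Finset.mul_sum, ← Finset.sum_add_distrib]
      refine Finset.sum_congr rfl fun a _ => Finset.sum_congr rfl fun b _ =>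
        Finset.sum_congr rfl fun c _ => ?_
      ring
    rw [signedEnergy, Int.cast_sum, Finset.sum_congr rfl h1, Finset.sum_add_distrib]
    congr 1
    · simp only [weightedCount, Finset.filter_true, Int.cast_sum, Finset.sum_filter, Finset.mul_sum,
        ← Finset.sum_add_distrib, ← Finset.sum_sub_distrib]
      refine Finset.sum_congr rfl fun x _ => ?_
      split_ifs <;> push_cast <;> ring
    · simp only [Finset.mul_sum]
      rw [Finset.sum_comm]
      refine Finset.sum_congr rfl fun a _ => ?_
      rw [Finset.sum_comm]
      refine Finset.sum_congr rfl fun b _ => ?_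
      rw [Finset.sum_comm]
  have h2 : ((signedEnergy A σ r t : ℝ) - (weightedCount σ r t (fun x => (n : ℤ) ∣ x.2.2.2 - x.2.1)
        + weightedCount σ r t (fun x => (n : ℤ) ∣ x.2.2.1 - x.2.1)
        + weightedCount σ r t (fun x => (n : ℤ) ∣ x.2.2.1 + x.2.2.2)
        - 2 / n * weightedCount σ r t (fun _ => True)) : ℝ)
      = (1 / n * ∑ a : ZMod n, ∑ b : ZMod n, ∑ c : ZMod n,
          (A.spectralL a b c - indicatorI a b c) *
            ∑ x ∈ energySet r t, (quadWeight σ x : ℂ) * quadPhase a b c x : ℂ) := by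
    push_cast
    rw [hmain]; ring
  rw [← Real.norm_eq_abs, ← Complex.norm_real, h2, norm_mul, norm_div, norm_one, Complex.norm_natCast]
  refine mul_le_mul_of_nonneg_left ?_ (by positivity)
  have hd0 : 0 ≤ maxDeviation A := (norm_nonneg _).trans (norm_spectralL_sub_indicatorI_le A 0 0 0)
  refine le_trans ?_ (mul_le_mul_of_nonneg_left (sum_norm_twisted_le hσ r t hQ) hd0)
  simp only [Finset.mul_sum (a := maxDeviation A)]
  refine norm_sum_le_of_le _ fun a _ => norm_sum_le_of_le _ fun b _ => norm_sum_le_of_le _ fun c _ => ?_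
  rw [norm_mul]
  exact mul_le_mul_of_nonneg_right (norm_spectralL_sub_indicatorI_le A a b c) (norm_nonneg _)

/-! ### Counts as sums of squared correlations and convolutions -/

/-- The correlation of `f` with itself at distance `u` on `[r, r + t)`. -/
noncomputable def intervalCorr (f : ℤ → ℤ) (r : ℤ) (t : ℕ) (u : ℤ) : ℤ :=
  ∑ x ∈ (Finset.Ico r (r + t) ×ˢ Finset.Ico r (r + t)).filter (fun x => x.1 - x.2 = u), f x.1 * f x.2

/-- The convolution of `f` with itself at `v` on `[r, r + t)`. -/
noncomputable def intervalConv (f : ℤ → ℤ) (r : ℤ) (t : ℕ) (v : ℤ) : ℤ :=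
  ∑ x ∈ (Finset.Ico r (r + t) ×ˢ Finset.Ico r (r + t)).filter (fun x => x.1 + x.2 = v), f x.1 * f x.2

lemma sum_sq_fiber {α : Type*} (X : Finset α) (φ : α → ℤ) (w : α → ℤ) (K : Finset ℤ) :
    ∑ u ∈ K, (∑ a ∈ X.filter (fun a => φ a = u), w a) ^ 2
      = ∑ y ∈ (X ×ˢ X).filter (fun y => φ y.1 = φ y.2 ∧ φ y.1 ∈ K), w y.1 * w y.2 := by
  rw [← Finset.sum_fiberwise_of_maps_to (s := (X ×ˢ X).filter (fun y => φ y.1 = φ y.2 ∧ φ y.1 ∈ K))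
    (t := K) (g := fun y : α × α => φ y.1) (fun y hy => (Finset.mem_filter.1 hy).2.2)]
  refine Finset.sum_congr rfl fun u hu => ?_
  rw [sq, Finset.sum_mul_sum, ← Finset.sum_product']
  refine Finset.sum_congr ?_ fun _ _ => rfl
  ext ⟨a, b⟩
  simp only [Finset.mem_product, Finset.mem_filter]
  constructor
  · rintro ⟨⟨ha, rfl⟩, hb, h⟩
    exact ⟨⟨⟨ha, hb⟩, h.symm, hu⟩, rfl⟩
  · rintro ⟨⟨⟨ha, hb⟩, h, -⟩, rfl⟩
    exact ⟨⟨ha, rfl⟩, hb, h.symm⟩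

/-- The product of the values of `f` at the four entries of a quadruple. -/
def quadProd (f : ℤ → ℤ) (x : ℤ × ℤ × ℤ × ℤ) : ℤ := f x.1 * f x.2.1 * f x.2.2.1 * f x.2.2.2

/-- The relation `x₁ + x₂ = x₃ + x₄` reads `x₁ - x₃ = x₄ - x₂`, so a quadruple is a pair of pairs
with the same difference. -/
lemma sum_intervalCorr_sq (f : ℤ → ℤ) (r : ℤ) (t : ℕ) (K : Finset ℤ) :
    ∑ u ∈ K, intervalCorr f r t u ^ 2
      = ∑ x ∈ (energySet r t).filter (fun x => x.2.2.2 - x.2.1 ∈ K), quadProd f x := by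
  simp only [intervalCorr]
  rw [sum_sq_fiber _ (fun x : ℤ × ℤ => x.1 - x.2)]
  refine Finset.sum_nbij' (fun y => (y.1.1, y.2.2, y.1.2, y.2.1))
    (fun x => ((x.1, x.2.2.1), (x.2.2.2, x.2.1))) ?_ ?_ (fun _ _ => rfl) (fun _ _ => rfl) ?_
  · rintro ⟨⟨a, b⟩, c, d⟩ h
    simp only [Finset.mem_filter, Finset.mem_product, Finset.mem_Ico, mem_energySet] at h ⊢
    refine ⟨by omega, ?_⟩
    rw [← h.2.1]; exact h.2.2
  · rintro ⟨a, b, c, d⟩ h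
    simp only [Finset.mem_filter, Finset.mem_product, Finset.mem_Ico, mem_energySet] at h ⊢
    refine ⟨by omega, by omega, ?_⟩
    rw [show a - c = d - b by omega]; exact h.2
  · rintro ⟨⟨a, b⟩, c, d⟩ h
    simp only [quadProd]; ring

lemma sum_intervalConv_sq (f : ℤ → ℤ) (r : ℤ) (t : ℕ) (K : Finset ℤ) :
    ∑ u ∈ K, intervalConv f r t u ^ 2
      = ∑ x ∈ (energySet r t).filter (fun x => x.2.2.1 + x.2.2.2 ∈ K), quadProd f x := by
  simp only [intervalConv]
  rw [sum_sq_fiber _ (fun x : ℤ × ℤ => x.1 + x.2)]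
  refine Finset.sum_nbij' (fun y => (y.1.1, y.1.2, y.2.1, y.2.2))
    (fun x => ((x.1, x.2.1), (x.2.2.1, x.2.2.2))) ?_ ?_ (fun _ _ => rfl) (fun _ _ => rfl) ?_
  · rintro ⟨⟨a, b⟩, c, d⟩ h
    simp only [Finset.mem_filter, Finset.mem_product, Finset.mem_Ico, mem_energySet] at h ⊢
    refine ⟨by omega, ?_⟩
    rw [← h.2.1]; exact h.2.2
  · rintro ⟨a, b, c, d⟩ h
    simp only [Finset.mem_filter, Finset.mem_product, Finset.mem_Ico, mem_energySet] at h ⊢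
    refine ⟨by omega, by omega, ?_⟩
    rw [h.1.2]; exact h.2
  · rintro ⟨⟨a, b⟩, c, d⟩ h
    simp only [quadProd]; ring

/-- Multiples of `n` between `-B n` and `B n`. -/
noncomputable def multiples (n B : ℕ) : Finset ℤ := (Finset.Icc (-B : ℤ) B).image fun m => m * (n : ℤ)

lemma mem_multiples {n B : ℕ} (hn : 0 < n) {u : ℤ} (hu : |u| ≤ B * n) :
    u ∈ multiples n B ↔ (n : ℤ) ∣ u := by
  simp only [multiples, Finset.mem_image, Finset.mem_Icc]
  constructor
  · rintro ⟨m, -, rfl⟩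
    exact Dvd.intro_left m rfl
  · rintro ⟨m, rfl⟩
    have hn' : (0 : ℤ) < n := by exact_mod_cast hn
    rw [abs_mul, abs_of_pos hn', mul_comm] at hu
    have := le_of_mul_le_mul_right hu hn'
    exact ⟨m, abs_le.1 this, mul_comm _ _⟩

lemma sum_multiples {n B : ℕ} (hn : 0 < n) (g : ℤ → ℤ) :
    ∑ u ∈ multiples n B, g u = ∑ m ∈ Finset.Icc (-B : ℤ) B, g (m * n) :=
  Finset.sum_image fun a _ b _ h =>
    mul_right_cancel₀ (b := (n : ℤ)) (by exact_mod_cast hn.ne') h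

lemma weightedCount_sub_eq {σ : ZMod 4 → ℤ} {r : ℤ} {t n B : ℕ} (hn : 0 < n) (hB : t ≤ B * n) :
    weightedCount σ r t (fun x => (n : ℤ) ∣ x.2.2.2 - x.2.1)
      = ∑ m ∈ Finset.Icc (-B : ℤ) B, intervalCorr (fun x => σ x) r t (m * n) ^ 2 := by
  have hB' : (t : ℤ) ≤ B * n := by exact_mod_cast hB
  rw [← sum_multiples hn (fun u => intervalCorr (fun x => σ x) r t u ^ 2), sum_intervalCorr_sq,
    weightedCount]
  refine Finset.sum_congr (Finset.ext fun x => ?_) fun _ _ => rfl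
  simp only [Finset.mem_filter, and_congr_right_iff]
  intro hx
  rw [mem_energySet] at hx
  rw [mem_multiples hn]
  rw [abs_le]; constructor <;> omega

lemma weightedCount_sub_swap {σ : ZMod 4 → ℤ} {r : ℤ} {t n : ℕ} :
    weightedCount σ r t (fun x => (n : ℤ) ∣ x.2.2.1 - x.2.1)
      = weightedCount σ r t (fun x => (n : ℤ) ∣ x.2.2.2 - x.2.1) := by
  classical
  unfold weightedCount
  refine Finset.sum_nbij' (fun x => (x.1, x.2.1, x.2.2.2, x.2.2.1))
    (fun x => (x.1, x.2.1, x.2.2.2, x.2.2.1)) ?_ ?_ (fun _ _ => rfl) (fun _ _ => rfl) ?_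
  · rintro ⟨a, b, c, d⟩ h
    simp only [Finset.mem_filter, mem_energySet] at h ⊢
    exact ⟨by omega, h.2⟩
  · rintro ⟨a, b, c, d⟩ h
    simp only [Finset.mem_filter, mem_energySet] at h ⊢
    exact ⟨by omega, h.2⟩
  · rintro ⟨a, b, c, d⟩ h
    simp only [quadWeight]; ring

/-- The sum `x₃ + x₄` is at most `2|r| + 2t` in modulus, so the multiples of `n` up to `B * n` cover
all its values divisible by `n`. -/
lemma weightedCount_add_eq {σ : ZMod 4 → ℤ} {r : ℤ} {t n B : ℕ} (hn : 0 < n)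
    (hB : 2 * |r| + 2 * t ≤ B * n) :
    weightedCount σ r t (fun x => (n : ℤ) ∣ x.2.2.1 + x.2.2.2)
      = ∑ m ∈ Finset.Icc (-B : ℤ) B, intervalConv (fun x => σ x) r t (m * n) ^ 2 := by
  rw [← sum_multiples hn (fun u => intervalConv (fun x => σ x) r t u ^ 2), sum_intervalConv_sq,
    weightedCount]
  refine Finset.sum_congr (Finset.ext fun x => ?_) fun _ _ => rfl
  simp only [Finset.mem_filter, and_congr_right_iff]
  intro hx
  rw [mem_energySet] at hx
  rw [mem_multiples hn]
  have h1 := le_abs_self r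
  have h2 := neg_abs_le r
  rw [abs_le]; constructor <;> omega

lemma weightedCount_true_eq {σ : ZMod 4 → ℤ} {r : ℤ} {t : ℕ} :
    weightedCount σ r t (fun _ => True)
      = ∑ u ∈ Finset.Ioo (-t : ℤ) t, intervalCorr (fun x => σ x) r t u ^ 2 := by
  rw [sum_intervalCorr_sq, weightedCount]
  refine Finset.sum_congr (Finset.ext fun x => ?_) fun _ _ => rfl
  simp only [Finset.mem_filter, and_congr_right_iff]
  intro hx
  rw [mem_energySet] at hx
  simp only [Finset.mem_Ioo, true_iff]
  omega

lemma signedEnergy_eq {n : ℕ} [NeZero n] (A : BinarySeq n) (σ : ZMod 4 → ℤ) (r : ℤ) (t : ℕ) :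
    signedEnergy A σ r t = ∑ u ∈ Finset.Ioo (-t : ℤ) t,
      intervalCorr (fun x => σ x * (A.periodicExt x : ℤ)) r t u ^ 2 := by
  rw [sum_intervalCorr_sq, signedEnergy, Finset.filter_true_of_mem]
  · refine Finset.sum_congr rfl fun x _ => ?_
    simp only [quadProd, quadWeight]; ring
  · intro x hx
    rw [mem_energySet] at hx
    rw [Finset.mem_Ioo]
    omega

/-! ### Correlations of sign patterns on an interval -/

lemma sum_Ico_int_eq {R : Type*} [AddCommMonoid R] (F : ℤ → R) (a b : ℤ) :
    ∑ x ∈ Finset.Ico a b, F x = ∑ i ∈ Finset.range (b - a).toNat, F (a + i) := by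
  refine Finset.sum_nbij' (fun x => (x - a).toNat) (fun i => a + i) ?_ ?_ ?_ ?_ ?_
  · intro x hx; rw [Finset.mem_Ico] at hx; rw [Finset.mem_range]; omega
  · intro x hx; rw [Finset.mem_range] at hx; rw [Finset.mem_Ico]; omega
  · intro x hx; rw [Finset.mem_Ico] at hx; omega
  · intro x hx; simp
  · intro x hx; rw [Finset.mem_Ico] at hx; congr 1; omega

lemma sum_four_consecutive (g : ZMod 4 → ℤ) (c : ZMod 4) :
    g c + g (c + 1) + g (c + 2) + g (c + 3) = ∑ y, g y := by
  rw [← Equiv.sum_comp (Equiv.addLeft c) g]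
  change _ = ∑ y : Fin 4, g (c + (show ZMod 4 from y))
  rw [Fin.sum_univ_four]
  nth_rewrite 1 [← add_zero c]
  rfl

/-- Blocks of four consecutive terms cancel, which leaves fewer than four terms of modulus at most
1. -/
lemma abs_sum_range_periodic_le {g : ZMod 4 → ℤ} (hg : ∀ y, |g y| ≤ 1) (h0 : ∑ y, g y = 0) (a : ℤ)
    (N : ℕ) : |∑ i ∈ Finset.range N, g ((a + i : ℤ) : ZMod 4)| ≤ 4 := by
  induction N using Nat.strong_induction_on with
  | _ N ih =>
    by_cases hN : N < 4
    · refine (Finset.abs_sum_le_sum_abs _ _).trans ?_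
      refine (Finset.sum_le_sum fun i _ => hg _).trans ?_
      simp; omega
    · obtain ⟨m, rfl⟩ : ∃ m, N = m + 4 := ⟨N - 4, by omega⟩
      have h := ih m (by omega)
      rw [add_comm m 4, Finset.sum_range_add]
      have h1 : ∑ i ∈ Finset.range 4, g ((a + i : ℤ) : ZMod 4) = 0 := by
        rw [← h0, ← sum_four_consecutive g a]
        simp [Finset.sum_range_succ]
      have h2 : ∀ i : ℕ, ((a + ((4 + i : ℕ) : ℤ) : ℤ) : ZMod 4) = ((a + i : ℤ) : ZMod 4) := by
        intro i
        push_cast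
        rw [show (4 : ZMod 4) = 0 from rfl, zero_add]
      rw [h1, zero_add]
      simp only [h2]
      exact h

lemma abs_sum_Ico_periodic_le {g : ZMod 4 → ℤ} (hg : ∀ y, |g y| ≤ 1) (h0 : ∑ y, g y = 0) (a b : ℤ) :
    |∑ x ∈ Finset.Ico a b, g (x : ZMod 4)| ≤ 4 := by
  rw [sum_Ico_int_eq]
  exact abs_sum_range_periodic_le hg h0 a _

lemma intervalCorr_eq (f : ℤ → ℤ) (r : ℤ) (t : ℕ) (u : ℤ) :
    intervalCorr f r t u
      = ∑ x ∈ Finset.Ico (max r (r - u)) (min (r + t) (r + t - u)), f (x + u) * f x := by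
  refine Finset.sum_nbij' (fun x => x.2) (fun x => (x + u, x)) ?_ ?_ ?_ (fun _ _ => rfl) ?_
  · rintro ⟨a, b⟩ h
    simp only [Finset.mem_filter, Finset.mem_product, Finset.mem_Ico] at h ⊢
    omega
  · rintro a h
    simp only [Finset.mem_filter, Finset.mem_product, Finset.mem_Ico] at h ⊢
    omega
  · rintro ⟨a, b⟩ h
    simp only [Finset.mem_filter, Prod.mk.injEq, and_true] at h ⊢
    omega
  · rintro ⟨a, b⟩ h
    simp only [Finset.mem_filter] at h ⊢
    rw [show b + u = a by omega]

lemma intervalConv_eq (f : ℤ → ℤ) (r : ℤ) (t : ℕ) (v : ℤ) :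
    intervalConv f r t v
      = ∑ x ∈ Finset.Ico (max r (v - r - t + 1)) (min (r + t) (v - r + 1)), f (v - x) * f x := by
  refine Finset.sum_nbij' (fun x => x.2) (fun x => (v - x, x)) ?_ ?_ ?_ (fun _ _ => rfl) ?_
  · rintro ⟨a, b⟩ h
    simp only [Finset.mem_filter, Finset.mem_product, Finset.mem_Ico] at h ⊢
    omega
  · rintro a h
    simp only [Finset.mem_filter, Finset.mem_product, Finset.mem_Ico] at h ⊢
    omega
  · rintro ⟨a, b⟩ h
    simp only [Finset.mem_filter, Prod.mk.injEq, and_true] at h ⊢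
    omega
  · rintro ⟨a, b⟩ h
    simp only [Finset.mem_filter] at h ⊢
    rw [show v - b = a by omega]

lemma intervalCorr_neg (f : ℤ → ℤ) (r : ℤ) (t : ℕ) (u : ℤ) :
    intervalCorr f r t (-u) = intervalCorr f r t u := by
  refine Finset.sum_nbij' Prod.swap Prod.swap ?_ ?_ (fun _ _ => rfl) (fun _ _ => rfl)
    (fun _ _ => mul_comm _ _)
  all_goals
    rintro ⟨a, b⟩ h
    simp only [Finset.mem_filter, Finset.mem_product, Finset.mem_Ico, Prod.swap] at h ⊢
    omega

/-- The sign pattern `σ` of period four has modulus `p` and offset `q`: the products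
`σ(y+u)σ(y)` and `σ(v-y)σ(y)` are constant if `p ∣ u` and `p ∣ v - q`, and have mean
zero over a period otherwise. -/
structure IsSignPattern (σ : ZMod 4 → ℤ) (p : ℕ) (q : ℤ) : Prop where
  abs_eq_one : ∀ y, |σ y| = 1
  corr_const : ∀ u : ℤ, (p : ℤ) ∣ u → ∃ e : ℤ, e ^ 2 = 1 ∧ ∀ y, σ (y + u) * σ y = e
  corr_sum : ∀ u : ℤ, ¬ (p : ℤ) ∣ u → ∑ y, σ (y + u) * σ y = 0
  conv_const : ∀ v : ℤ, (p : ℤ) ∣ v - q → ∃ e : ℤ, e ^ 2 = 1 ∧ ∀ y, σ (v - y) * σ y = e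
  conv_sum : ∀ v : ℤ, ¬ (p : ℤ) ∣ v - q → ∑ y, σ (v - y) * σ y = 0

lemma toNat_sq_eq_max (z : ℤ) : ((z.toNat : ℝ)) ^ 2 = max 0 (z : ℝ) ^ 2 := by
  have : ((z.toNat : ℤ) : ℝ) = max (z : ℝ) 0 := by rw [Int.toNat_eq_max]; push_cast; rfl
  rw [max_comm, ← this]; norm_cast

namespace IsSignPattern

variable {σ : ZMod 4 → ℤ} {p : ℕ} {q : ℤ}

lemma intervalCorr_sq (h : IsSignPattern σ p q) (r : ℤ) (t : ℕ) {u : ℤ} (hu : (p : ℤ) ∣ u) :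
    (intervalCorr (fun x => σ x) r t u : ℝ) ^ 2 = max 0 ((t : ℝ) - |(u : ℝ)|) ^ 2 := by
  obtain ⟨e, he, hc⟩ := h.corr_const u hu
  have h1 : intervalCorr (fun x => σ x) r t u = (t - |u|).toNat * e := by
    rw [intervalCorr_eq, Finset.sum_congr rfl fun x _ => by rw [Int.cast_add, hc],
      Finset.sum_const, Int.card_Ico, nsmul_eq_mul]
    congr 2
    rcases abs_cases u with ⟨h, _⟩ | ⟨h, _⟩ <;> rw [h] <;> omega
  have he' : (e : ℝ) ^ 2 = 1 := by exact_mod_cast he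
  rw [h1]
  push_cast
  rw [mul_pow, he', mul_one, toNat_sq_eq_max]
  push_cast; rfl

lemma intervalCorr_sq_le (h : IsSignPattern σ p q) (r : ℤ) (t : ℕ) {u : ℤ} (hu : ¬ (p : ℤ) ∣ u) :
    (intervalCorr (fun x => σ x) r t u : ℝ) ^ 2 ≤ 16 := by
  have h1 := abs_sum_Ico_periodic_le (g := fun y => σ (y + u) * σ y)
    (fun y => by rw [abs_mul, h.abs_eq_one, h.abs_eq_one, one_mul]) (h.corr_sum u hu)
    (max r (r - u)) (min (r + t) (r + t - u))
  have h2 : |intervalCorr (fun x => σ x) r t u| ≤ 4 := by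
    rw [intervalCorr_eq]
    simpa only [Int.cast_add] using h1
  have : intervalCorr (fun x => σ x) r t u ^ 2 ≤ 16 := by
    rw [← sq_abs]; nlinarith [abs_nonneg (intervalCorr (fun x => σ x) r t u)]
  exact_mod_cast this

/-- All products equal the same sign, so only the number of pairs with sum `v` matters. It decreases
linearly with the distance of `v` from the central value `2r + t - 1`. -/
lemma intervalConv_sq (h : IsSignPattern σ p q) (r : ℤ) (t : ℕ) {v : ℤ} (hv : (p : ℤ) ∣ v - q) :
    (intervalConv (fun x => σ x) r t v : ℝ) ^ 2
      = max 0 ((t : ℝ) - |(v : ℝ) - 2 * r - t + 1|) ^ 2 := by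
  obtain ⟨e, he, hc⟩ := h.conv_const v hv
  have h1 : intervalConv (fun x => σ x) r t v = (t - |v - 2 * r - t + 1|).toNat * e := by
    rw [intervalConv_eq, Finset.sum_congr rfl fun x _ => by rw [Int.cast_sub, hc],
      Finset.sum_const, Int.card_Ico, nsmul_eq_mul]
    congr 2
    rcases abs_cases (v - 2 * r - t + 1) with ⟨h, _⟩ | ⟨h, _⟩ <;> rw [h] <;> omega
  have he' : (e : ℝ) ^ 2 = 1 := by exact_mod_cast he
  rw [h1]
  push_cast
  rw [mul_pow, he', mul_one, toNat_sq_eq_max]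
  push_cast; rfl

lemma intervalConv_sq_le (h : IsSignPattern σ p q) (r : ℤ) (t : ℕ) {v : ℤ}
    (hv : ¬ (p : ℤ) ∣ v - q) : (intervalConv (fun x => σ x) r t v : ℝ) ^ 2 ≤ 16 := by
  have h1 := abs_sum_Ico_periodic_le (g := fun y => σ (v - y) * σ y)
    (fun y => by rw [abs_mul, h.abs_eq_one, h.abs_eq_one, one_mul]) (h.conv_sum v hv)
    (max r (v - r - t + 1)) (min (r + t) (v - r + 1))
  have h2 : |intervalConv (fun x => σ x) r t v| ≤ 4 := by
    rw [intervalConv_eq]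
    simpa only [Int.cast_sub] using h1
  have : intervalConv (fun x => σ x) r t v ^ 2 ≤ 16 := by
    rw [← sq_abs]; nlinarith [abs_nonneg (intervalConv (fun x => σ x) r t v)]
  exact_mod_cast this

end IsSignPattern

/-! ### The merit factor in terms of the energy -/

lemma sum_Ioo_even {R : Type*} [CommRing R] (g : ℤ → R) (hg : ∀ u, g (-u) = g u) {t : ℕ} (ht : 0 < t) :
    ∑ u ∈ Finset.Ioo (-t : ℤ) t, g u = g 0 + 2 * ∑ u ∈ Finset.Icc 1 (t - 1), g (u : ℤ) := by
  obtain ⟨k, rfl⟩ : ∃ k, t = k + 1 := ⟨t - 1, by omega⟩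
  clear ht
  rw [Nat.add_sub_cancel]
  induction k with
  | zero =>
    have : Finset.Ioo (-((0 + 1 : ℕ) : ℤ)) ((0 + 1 : ℕ) : ℤ) = {0} := by
      ext x; simp only [Finset.mem_Ioo, Finset.mem_singleton]; omega
    rw [this]; simp
  | succ k ih =>
    have h : Finset.Ioo (-((k + 1 + 1 : ℕ) : ℤ)) ((k + 1 + 1 : ℕ) : ℤ)
        = insert ((k + 1 : ℕ) : ℤ) (insert (-((k + 1 : ℕ) : ℤ))
          (Finset.Ioo (-((k + 1 : ℕ) : ℤ)) ((k + 1 : ℕ) : ℤ))) := by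
      ext x; simp only [Finset.mem_Ioo, Finset.mem_insert]; omega
    rw [h, Finset.sum_insert, Finset.sum_insert, ih, Finset.sum_Icc_succ_top (by omega), hg]
    · ring
    · simp
    · simp only [Finset.mem_insert, Finset.mem_Ioo]; omega

namespace BinarySeq

lemma autocorr_eq_intervalCorr {t : ℕ} (b : BinarySeq t) (f : ℤ → ℤ) (r : ℤ)
    (hb : ∀ j : Fin t, (b j : ℤ) = f ((j : ℕ) + r)) (u : ℕ) :
    autocorr b u = intervalCorr f r t u := by
  rw [intervalCorr_eq, max_eq_left (by omega), min_eq_right (by omega), sum_Ico_int_eq, autocorr,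
    show (r + t - (u : ℤ) - r).toNat = t - u by omega, ← Fin.sum_univ_eq_sum_range
      (fun i => f (r + i + u) * f (r + i))]
  refine Finset.sum_congr rfl fun j _ => ?_
  rw [hb, hb, mul_comm]
  congr 2
  · push_cast; ring
  · ring

lemma two_mul_sum_autocorr_sq {t : ℕ} (ht : 0 < t) (b : BinarySeq t) (f : ℤ → ℤ) (r : ℤ)
    (hb : ∀ j : Fin t, (b j : ℤ) = f ((j : ℕ) + r)) (hf : ∀ x, f x ^ 2 = 1) :
    2 * ∑ u ∈ Finset.Icc 1 (t - 1), autocorr b u ^ 2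
      = ∑ u ∈ Finset.Ioo (-t : ℤ) t, intervalCorr f r t u ^ 2 - (t : ℤ) ^ 2 := by
  rw [sum_Ioo_even _ (fun u => by rw [intervalCorr_neg]) ht]
  have h0 : intervalCorr f r t 0 = t := by
    rw [intervalCorr_eq]
    simp [← sq, hf]
  rw [h0]
  simp only [autocorr_eq_intervalCorr b f r hb]
  ring

end BinarySeq

/-! ### Positivity of `1 / g` -/

/-- The cubic `P(y) = y(y+1)(2y+1)/6` satisfies `P(y) - P(y-1) = y ^ 2`, so for `y ≥ 0` the
difference is the same at `y - 1`. This descends to `-1 ≤ y ≤ 0`, where the sum vanishes and `P`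
itself is small. -/
lemma abs_sum_sq_sub_cubic_le (N : ℕ) : ∀ y : ℝ, -1 ≤ y → y ≤ N →
    |∑ m ∈ Finset.range N, max 0 (y - m) ^ 2 - y * (y + 1) * (2 * y + 1) / 6| ≤ 1 / 60 := by
  -- With `s = 2y + 1` the cubic is `(s ^ 3 - s) / 24`, whose extrema on `[-1, 1]` are at `s = ±1/√3
  -- ≈ ±0.577`. The factors in the hints approximate `(s ± 1/√3) ^ 2 (s ∓ 2/√3)`.
  have base : ∀ y : ℝ, -1 ≤ y → y ≤ 0 → |0 - y * (y + 1) * (2 * y + 1) / 6| ≤ 1 / 60 := by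
    intro y h1 h2
    rw [abs_le]
    constructor
    · nlinarith [mul_nonneg (by linarith : 0 ≤ -(2 * y + 1) + 1.16) (sq_nonneg (2 * y + 1 + 0.577))]
    · nlinarith [mul_nonneg (by linarith : 0 ≤ (2 * y + 1) + 1.16) (sq_nonneg (2 * y + 1 - 0.577))]
  induction N with
  | zero =>
    intro y h1 h2
    simpa using base y h1 (by simpa using h2)
  | succ N ih =>
    intro y h1 h2
    rcases le_total y 0 with hy | hy
    · rw [Finset.sum_eq_zero]
      · exact base y h1 hy
      · intro m _
        have : (0 : ℝ) ≤ m := Nat.cast_nonneg m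
        rw [max_eq_left (by linarith)]; norm_num
    · have := ih (y - 1) (by linarith) (by push_cast at h2; linarith)
      rw [Finset.sum_range_succ', Nat.cast_zero, sub_zero, max_eq_right hy]
      have e : ∀ m : ℕ, y - ((m + 1 : ℕ) : ℝ) = y - 1 - m := fun m => by push_cast; ring
      simp only [e]
      convert this using 2
      ring

lemma gTerm_eq_zero {R T : ℝ} (hT : 0 < T) {m : ℤ} (hm : (m : ℝ) ≤ 2 * R ∨ 2 * R + 2 * T ≤ m) :
    max 0 (1 - |1 + (2 * R - (m : ℝ)) / T|) ^ 2 = 0 := by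
  have : 1 ≤ |1 + (2 * R - (m : ℝ)) / T| := by
    rw [le_abs]
    rcases hm with h | h
    · left
      have : 0 ≤ (2 * R - (m : ℝ)) / T := div_nonneg (by linarith) hT.le
      linarith
    · right
      have : (2 * R - (m : ℝ)) / T ≤ -2 := by rw [div_le_iff₀ hT]; linarith
      linarith
  rw [max_eq_left (by linarith)]; norm_num

lemma summable_gTerm (R : ℝ) {T : ℝ} (hT : 0 < T) :
    Summable fun m : ℤ => max 0 (1 - |1 + (2 * R - (m : ℝ)) / T|) ^ 2 := by
  refine summable_of_ne_finset_zero (s := Finset.Icc ⌊2 * R⌋ ⌈2 * R + 2 * T⌉) fun m hm => ?_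
  refine gTerm_eq_zero hT ?_
  rw [Finset.mem_Icc, not_and_or, not_le, not_le] at hm
  rcases hm with h | h
  · left; linarith [Int.lt_floor_iff.1 h]
  · right; linarith [Int.ceil_lt_iff.1 h]

lemma tsum_pnat_gTerm {T : ℝ} (hT : 0 < T) {N : ℕ} (hN : T ≤ N) :
    ∑' m : ℕ+, max 0 (1 - (m : ℝ) / T) ^ 2
      = ∑ m ∈ Finset.range N, max 0 (1 - ((m + 1 : ℕ) : ℝ) / T) ^ 2 := by
  have h := tsum_pnat_eq_tsum_succ (f := fun m : ℕ => max 0 (1 - (m : ℝ) / T) ^ 2)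
  rw [h]
  refine tsum_eq_sum fun m hm => ?_
  rw [Finset.mem_range, not_lt] at hm
  have : 1 ≤ ((m + 1 : ℕ) : ℝ) / T := by
    rw [le_div_iff₀ hT, one_mul]
    exact hN.trans (by exact_mod_cast (by omega : N ≤ m + 1))
  rw [max_eq_left (by linarith)]; norm_num

/-- Centred at `2R + T`, the integers on the two sides lie at distances `f + j` and `1 - f + j`,
with `f` the fractional part. Only a lower bound is needed, so a finite part of the series suffices.
-/
lemma sum_two_sided_le_tsum (R : ℝ) {T : ℝ} (hT : 0 < T) (N : ℕ) :
    ∑ j ∈ Finset.range N, max 0 (1 - (Int.fract (2 * R + T) + j) / T) ^ 2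
      + ∑ j ∈ Finset.range N, max 0 (1 - (1 - Int.fract (2 * R + T) + j) / T) ^ 2
      ≤ ∑' m : ℤ, max 0 (1 - |1 + (2 * R - (m : ℝ)) / T|) ^ 2 := by
  set k := ⌊2 * R + T⌋ with hk
  have hf : (k : ℝ) + Int.fract (2 * R + T) = 2 * R + T := Int.floor_add_fract _
  have hf0 := Int.fract_nonneg (2 * R + T)
  have hf1 := Int.fract_lt_one (2 * R + T)
  set f := Int.fract (2 * R + T)
  let s₁ := (Finset.range N).image fun j : ℕ => k - (j : ℤ)
  let s₂ := (Finset.range N).image fun j : ℕ => k + 1 + (j : ℤ)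
  have hdisj : Disjoint s₁ s₂ := by
    rw [Finset.disjoint_left]
    intro x h1 h2
    obtain ⟨a, -, rfl⟩ := Finset.mem_image.1 h1
    obtain ⟨b, -, h⟩ := Finset.mem_image.1 h2
    omega
  refine le_trans (le_of_eq ?_) ((summable_gTerm R hT).sum_le_tsum (s₁ ∪ s₂) fun _ _ => sq_nonneg _)
  rw [Finset.sum_union hdisj, Finset.sum_image (fun a _ b _ h => by simpa using h),
    Finset.sum_image (fun a _ b _ h => by simpa using h)]
  congr 1 <;> refine Finset.sum_congr rfl fun j _ => ?_
  · rw [show 1 + (2 * R - ((k - (j : ℤ) : ℤ) : ℝ)) / T = (f + j) / T by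
      rw [eq_div_iff hT.ne', add_mul, div_mul_cancel₀ _ hT.ne']; push_cast; linarith,
      abs_of_nonneg (by positivity)]
  · rw [show 1 + (2 * R - ((k + 1 + (j : ℤ) : ℤ) : ℝ)) / T = -((1 - f + j) / T) by
      rw [← neg_div, eq_div_iff hT.ne', add_mul, div_mul_cancel₀ _ hT.ne']; push_cast; linarith,
      abs_neg, abs_of_nonneg (div_nonneg (add_nonneg (by linarith) (by positivity)) hT.le)]

lemma gRecip_ge (R : ℝ) {T : ℝ} (hT : 0 < T) {N : ℕ} (hN : T ≤ N) :
    ∃ f : ℝ, 0 ≤ f ∧ f ≤ 1 ∧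
      T ^ 2 - 4 * T ^ 3 / 3 + 4 * ∑ j ∈ Finset.range N, max 0 (T - 1 - j) ^ 2
      + ∑ j ∈ Finset.range N, max 0 (T - f - j) ^ 2
      + ∑ j ∈ Finset.range N, max 0 (T - 1 + f - j) ^ 2 ≤ T ^ 2 * gRecip R T := by
  refine ⟨Int.fract (2 * R + T), Int.fract_nonneg _, (Int.fract_lt_one _).le, ?_⟩
  have h := sum_two_sided_le_tsum R hT N
  set f := Int.fract (2 * R + T)
  have e : ∀ y z : ℝ, T - y = z → T ^ 2 * max 0 (1 - y / T) ^ 2 = max 0 z ^ 2 := by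
    rintro y z rfl
    rw [← mul_pow, mul_max_of_nonneg _ _ hT.le, mul_zero, mul_sub, mul_div_cancel₀ _ hT.ne', mul_one]
  rw [gRecip, tsum_pnat_gTerm hT hN]
  have h' := mul_le_mul_of_nonneg_left h (sq_nonneg T)
  simp only [mul_add, Finset.mul_sum] at h'
  rw [Finset.sum_congr rfl fun (j : ℕ) _ => e (f + j) (T - f - j) (by ring),
    Finset.sum_congr rfl fun (j : ℕ) _ => e (1 - f + j) (T - 1 + f - j) (by ring)] at h'
  have h1 : T ^ 2 * ∑ m ∈ Finset.range N, max 0 (1 - ((m + 1 : ℕ) : ℝ) / T) ^ 2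
      = ∑ j ∈ Finset.range N, max 0 (T - 1 - j) ^ 2 := by
    rw [Finset.mul_sum]
    exact Finset.sum_congr rfl fun j _ => e _ _ (by push_cast; ring)
  rw [← h1]
  nlinarith

/-- The negative term `-4T/3` is compensated by `1` alone for `T < 3/4`, by the two nearest terms of
the second series up to `T = 1`, and beyond that by comparing all sums with cubics. -/
lemma gRecip_pos (R : ℝ) {T : ℝ} (hT : 0 < T) : 0 < gRecip R T := by
  suffices h : 0 < T ^ 2 * gRecip R T from pos_of_mul_pos_right h (sq_nonneg T)
  rcases le_total T 1 with h1 | h1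
  · obtain ⟨f, hf0, hf1, h⟩ := gRecip_ge R hT (N := 1) (by simpa using h1)
    refine lt_of_lt_of_le ?_ h
    simp only [Finset.range_one, Finset.sum_singleton, Nat.cast_zero, sub_zero]
    have a0 := le_max_right 0 (T - f)
    have b0 := le_max_right 0 (T - 1 + f)
    set a := max 0 (T - f)
    set b := max 0 (T - 1 + f)
    have c0 := sq_nonneg (max 0 (T - 1))
    rcases lt_or_ge T (3 / 4) with h2 | h2
    · have : 0 < T ^ 2 * (1 - 4 * T / 3) := by
        have : 0 < 1 - 4 * T / 3 := by linarith
        positivity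
      nlinarith [sq_nonneg a, sq_nonneg b]
    -- Since `a + b ≥ (T - f) + (T - 1 + f) = 2T - 1`, the unknown `f` drops out.
    · have hab : (2 * T - 1) ^ 2 / 2 ≤ a ^ 2 + b ^ 2 := by
        nlinarith [sq_nonneg (a - b), mul_self_le_mul_self (by linarith : 0 ≤ 2 * T - 1)
          (by linarith : 2 * T - 1 ≤ a + b)]
      have : 0 < T ^ 2 - 4 * T ^ 3 / 3 + (2 * T - 1) ^ 2 / 2 := by
        nlinarith [mul_nonneg (mul_nonneg hT.le (sub_nonneg.2 h1)) (sub_nonneg.2 h2),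
          mul_nonneg (sub_nonneg.2 h1) (sub_nonneg.2 h2), sq_nonneg (T - 1)]
      linarith
  · obtain ⟨N, hN⟩ := exists_nat_ge T
    obtain ⟨f, hf0, hf1, h⟩ := gRecip_ge R hT hN
    refine lt_of_lt_of_le ?_ h
    have c1 := (abs_le.1 (abs_sum_sq_sub_cubic_le N (T - 1) (by linarith) (by linarith))).1
    have c2 := (abs_le.1 (abs_sum_sq_sub_cubic_le N (T - f) (by linarith) (by linarith))).1
    have c3 := (abs_le.1 (abs_sum_sq_sub_cubic_le N (T - 1 + f) (by linarith) (by linarith))).1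
    -- This is the lower bound of `gRecip_ge` with every sum replaced by its cubic. The six sums,
    -- counted with multiplicity, cost `6/60 = 1/10`.
    have : 0 < 2 * T ^ 3 / 3 - T ^ 2 + T / 2 + 2 * T * (1 / 2 - f) ^ 2 - 1 / 10 := by
      have : 0 ≤ 2 * T * (1 / 2 - f) ^ 2 := by positivity
      nlinarith [mul_nonneg (mul_nonneg hT.le hT.le) (sub_nonneg.2 h1), sq_nonneg (T - 1)]
    nlinarith

/-! ### Limits of the divisibility terms -/

lemma sum_progression_eq_tsum {p : ℕ} (hp : 0 < p) (q : ℤ) (K : Finset ℤ) (F : ℤ → ℝ)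
    (hF : ∀ m ∉ K, F m = 0) :
    ∑ m ∈ K, (if (p : ℤ) ∣ m - q then F m else 0) = ∑' m : ℤ, F (p * m + q) := by
  have hp' : (p : ℤ) ≠ 0 := by exact_mod_cast hp.ne'
  rw [← Finset.sum_filter, tsum_eq_sum
    (s := (K.filter fun m => (p : ℤ) ∣ m - q).image fun m => (m - q) / p)]
  · rw [Finset.sum_image]
    · refine Finset.sum_congr rfl fun m hm => ?_
      rw [Int.mul_ediv_cancel' (Finset.mem_filter.1 hm).2, sub_add_cancel]
    · intro a ha b hb h
      have ha := Int.mul_ediv_cancel' (Finset.mem_filter.1 ha).2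
      have hb := Int.mul_ediv_cancel' (Finset.mem_filter.1 hb).2
      dsimp only at h
      rw [h] at ha
      linarith
  · intro m hm
    refine hF _ fun h => hm (Finset.mem_image.2 ⟨p * m + q, Finset.mem_filter.2 ⟨h, by simp⟩, ?_⟩)
    rw [add_sub_cancel_right, Int.mul_ediv_cancel_left _ hp']

lemma tsum_int_gTerm {T : ℝ} (hT : 0 < T) :
    ∑' m : ℤ, max 0 (1 - |(m : ℝ)| / T) ^ 2 = 1 + 2 * ∑' m : ℕ+, max 0 (1 - (m : ℝ) / T) ^ 2 := by
  obtain ⟨N, hN⟩ := exists_nat_ge T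
  rw [tsum_pnat_gTerm hT hN, tsum_eq_sum (s := Finset.Ioo (-(N + 1 : ℕ) : ℤ) (N + 1 : ℕ)),
    sum_Ioo_even (fun m : ℤ => max 0 (1 - |(m : ℝ)| / T) ^ 2) (fun u => by simp) (by omega)]
  · rw [Nat.add_sub_cancel, Finset.range_eq_Ico, Finset.sum_Ico_add' (fun m : ℕ =>
      max 0 (1 - (m : ℝ) / T) ^ 2) 0 N 1]
    simp only [Int.cast_zero, abs_zero, zero_div, sub_zero, Int.cast_natCast, Nat.abs_cast]
    norm_num
    rfl
  · intro m hm
    have h1 : (N : ℤ) ≤ |m| := by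
      rw [Finset.mem_Ioo] at hm
      rcases abs_cases m with ⟨h, _⟩ | ⟨h, _⟩ <;> rw [h] <;> push_cast at hm <;> omega
    have h2 : (N : ℝ) ≤ |(m : ℝ)| := by exact_mod_cast h1
    have : 1 ≤ |(m : ℝ)| / T := by rw [le_div_iff₀ hT]; linarith
    rw [max_eq_left (by linarith)]; norm_num

lemma max_zero_sq_div {x t : ℝ} (ht : 0 < t) : max 0 x ^ 2 / t ^ 2 = max 0 (x / t) ^ 2 := by
  rw [← div_pow, ← max_div_div_right ht.le, zero_div]

section Limits

variable {ι : Type*} {l : Filter ι} {n : ι → ℕ} {t : ι → ℕ} {r : ι → ℤ} {σ : ZMod 4 → ℤ} {p : ℕ}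
  {q : ℤ} {R T : ℝ}

lemma tendsto_size_ratio (hp : 0 < p) (hT : 0 < T)
    (ht : Tendsto (fun i => (t i : ℝ) / (p * n i)) l (𝓝 T)) :
    Tendsto (fun i => (n i : ℝ) / t i) l (𝓝 (1 / (p * T))) := by
  have hp' : (p : ℝ) ≠ 0 := by exact_mod_cast hp.ne'
  have h := (ht.inv₀ hT.ne').const_mul (1 / (p : ℝ))
  convert h using 1
  · ext i
    rw [inv_div, one_div, ← mul_div_assoc, inv_mul_cancel_left₀ hp']
  · congr 1; field_simp

lemma tendsto_size_atTop (hp : 0 < p) (hT : 0 < T) (hn : Tendsto (fun i => (n i : ℝ)) l atTop)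
    (ht : Tendsto (fun i => (t i : ℝ) / (p * n i)) l (𝓝 T)) :
    Tendsto (fun i => (t i : ℝ)) l atTop := by
  have hp' : (0 : ℝ) < p := by exact_mod_cast hp
  have h := ht.pos_mul_atTop hT (hn.const_mul_atTop hp')
  refine h.congr' ?_
  filter_upwards [hn.eventually_gt_atTop 0] with i hi
  field_simp

lemma tendsto_sq_div_of_le {f : ι → ℝ} (hf0 : ∀ i, 0 ≤ f i)
    (ht : Tendsto (fun i => (t i : ℝ)) l atTop) (hf : ∀ᶠ i in l, f i ≤ 16) :
    Tendsto (fun i => f i / (t i : ℝ) ^ 2) l (𝓝 0) := by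
  have h1 : Tendsto (fun i => (16 : ℝ) / (t i : ℝ) ^ 2) l (𝓝 0) :=
    tendsto_const_nhds.div_atTop ((tendsto_pow_atTop two_ne_zero).comp ht)
  refine tendsto_of_tendsto_of_tendsto_of_le_of_le' tendsto_const_nhds h1
    (Eventually.of_forall fun i => by have := hf0 i; positivity) ?_
  filter_upwards [hf] with i hi
  gcongr

/-- The number of shifts `m * n` in play stays bounded, so limits may be taken term by term. Shifts
off the progression contribute at most `16 / t ^ 2`; the others converge to a series in `m / p`. -/
lemma tendsto_weightedCount_sub (h : IsSignPattern σ p q) (hp : 0 < p) (hT : 0 < T)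
    (hn : Tendsto (fun i => (n i : ℝ)) l atTop)
    (hdvd : ∀ᶠ i in l, ∀ m : ℤ, (p : ℤ) ∣ m * n i ↔ (p : ℤ) ∣ m)
    (ht : Tendsto (fun i => (t i : ℝ) / (p * n i)) l (𝓝 T)) :
    Tendsto (fun i => (weightedCount σ (r i) (t i) (fun x => (n i : ℤ) ∣ x.2.2.2 - x.2.1) : ℝ)
      / (t i : ℝ) ^ 2) l (𝓝 (1 + 2 * ∑' m : ℕ+, max 0 (1 - (m : ℝ) / T) ^ 2)) := by
  have hp' : (0 : ℝ) < p := by exact_mod_cast hp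
  have htop := tendsto_size_atTop hp hT hn ht
  have hratio := tendsto_size_ratio hp hT ht
  -- Strictly beyond `p * T`, so that `t ≤ B * n` eventually, and the limit terms with `|m| > B`
  -- vanish.
  obtain ⟨B, hB⟩ := exists_nat_gt (p * T)
  have hterm : ∀ m : ℤ, Tendsto (fun i =>
      (intervalCorr (fun x => σ x) (r i) (t i) (m * n i) : ℝ) ^ 2 / (t i : ℝ) ^ 2) l
      (𝓝 (if (p : ℤ) ∣ m - 0 then max 0 (1 - |(m : ℝ)| / (p * T)) ^ 2 else 0)) := by
    intro m
    rw [sub_zero]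
    split_ifs with hm
    · have hl : Tendsto (fun i => max 0 (1 - |(m : ℝ)| * ((n i : ℝ) / t i)) ^ 2) l
          (𝓝 (max 0 (1 - |(m : ℝ)| * (1 / (p * T))) ^ 2)) :=
        (tendsto_const_nhds.max (tendsto_const_nhds.sub (hratio.const_mul _))).pow 2
      rw [mul_one_div] at hl
      refine hl.congr' ?_
      filter_upwards [htop.eventually_gt_atTop 0] with i hi
      rw [h.intervalCorr_sq (r i) (t i) (Dvd.dvd.mul_right hm _), max_zero_sq_div hi]
      congr 2
      push_cast
      rw [abs_mul, Nat.abs_cast]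
      field_simp
    · refine tendsto_sq_div_of_le (fun i => sq_nonneg _) htop ?_
      filter_upwards [hdvd] with i hi
      exact h.intervalCorr_sq_le _ _ (fun hh => hm ((hi m).1 hh))
  have hsum := tendsto_finsetSum (Finset.Icc (-B : ℤ) B) fun m _ => hterm m
  rw [sum_progression_eq_tsum hp 0 (Finset.Icc (-B : ℤ) B)
    (fun m => max 0 (1 - |(m : ℝ)| / (p * T)) ^ 2)] at hsum
  · have e : ∀ m : ℤ, max 0 (1 - |((p * m + 0 : ℤ) : ℝ)| / (p * T)) ^ 2
        = max 0 (1 - |(m : ℝ)| / T) ^ 2 := fun m => by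
      push_cast
      rw [add_zero, abs_mul, Nat.abs_cast, mul_div_mul_left _ _ hp'.ne']
    simp only [e, tsum_int_gTerm hT] at hsum
    refine hsum.congr' ?_
    have hlt : ∀ᶠ i in l, (t i : ℝ) / (p * n i) < B / p :=
      ht.eventually_lt_const (by rw [lt_div_iff₀ hp']; linarith)
    filter_upwards [hlt, hn.eventually_gt_atTop 0] with i h1 h2
    rw [div_lt_div_iff₀ (by positivity) hp'] at h1
    have h3 : t i ≤ B * n i := by
      have : (t i : ℝ) * p < B * n i * p := by linarith
      exact_mod_cast (lt_of_mul_lt_mul_right this hp'.le).le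
    rw [weightedCount_sub_eq (by exact_mod_cast h2) h3, ← Finset.sum_div]
    push_cast; rfl
  · intro m hm
    have h1 : (B : ℤ) ≤ |m| := by
      rw [Finset.mem_Icc, ← abs_le] at hm
      omega
    have h2 : (B : ℝ) ≤ |(m : ℝ)| := by exact_mod_cast h1
    have : 1 ≤ |(m : ℝ)| / (p * T) := by rw [le_div_iff₀ (by positivity)]; linarith
    rw [max_eq_left (by linarith)]; norm_num

lemma tendsto_weightedCount_add (h : IsSignPattern σ p q) (hp : 0 < p) (hT : 0 < T)
    (hn : Tendsto (fun i => (n i : ℝ)) l atTop)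
    (hdvd : ∀ᶠ i in l, ∀ m : ℤ, (p : ℤ) ∣ m * n i - q ↔ (p : ℤ) ∣ m - q)
    (hr : Tendsto (fun i => (r i : ℝ) / (p * n i)) l (𝓝 R))
    (ht : Tendsto (fun i => (t i : ℝ) / (p * n i)) l (𝓝 T)) :
    Tendsto (fun i => (weightedCount σ (r i) (t i) (fun x => (n i : ℤ) ∣ x.2.2.1 + x.2.2.2) : ℝ)
      / (t i : ℝ) ^ 2) l
      (𝓝 (∑' m : ℤ, max 0 (1 - |1 + (2 * (R - q / (2 * p)) - (m : ℝ)) / T|) ^ 2)) := by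
  have hp' : (0 : ℝ) < p := by exact_mod_cast hp
  have htop := tendsto_size_atTop hp hT hn ht
  have hratio := tendsto_size_ratio hp hT ht
  have hrt : Tendsto (fun i => (r i : ℝ) / t i) l (𝓝 (R / T)) := by
    refine (hr.div ht hT.ne').congr' ?_
    filter_upwards [hn.eventually_gt_atTop 0] with i hi
    simp only [Pi.div_apply]
    rw [div_div_div_cancel_right₀ (by positivity)]
  have hinv : Tendsto (fun i => (1 : ℝ) / t i) l (𝓝 0) := tendsto_const_nhds.div_atTop htop
  obtain ⟨B, hB⟩ := exists_nat_gt (p * (2 * |R| + 2 * T))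
  have hterm : ∀ m : ℤ, Tendsto (fun i =>
      (intervalConv (fun x => σ x) (r i) (t i) (m * n i) : ℝ) ^ 2 / (t i : ℝ) ^ 2) l
      (𝓝 (if (p : ℤ) ∣ m - q then max 0 (1 - |1 + (2 * R - (m : ℝ) / p) / T|) ^ 2 else 0)) := by
    intro m
    split_ifs with hm
    · have hl : Tendsto (fun i => max 0 (1 - |(m : ℝ) * ((n i : ℝ) / t i) - 2 * ((r i : ℝ) / t i) - 1
          + 1 / t i|) ^ 2) l
          (𝓝 (max 0 (1 - |(m : ℝ) * (1 / (p * T)) - 2 * (R / T) - 1 + 0|) ^ 2)) :=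
        (tendsto_const_nhds.max (tendsto_const_nhds.sub
          ((((hratio.const_mul _).sub (hrt.const_mul _)).sub_const 1).add hinv).abs)).pow 2
      rw [show (m : ℝ) * (1 / (p * T)) - 2 * (R / T) - 1 + 0 = -(1 + (2 * R - (m : ℝ) / p) / T) by
        field_simp; ring, abs_neg] at hl
      refine hl.congr' ?_
      filter_upwards [htop.eventually_gt_atTop 0, hdvd] with i hi hd
      rw [h.intervalConv_sq (r i) (t i) ((hd m).2 hm), max_zero_sq_div hi]
      congr 2
      rw [sub_div, div_self hi.ne']
      congr 1
      rw [← abs_of_pos hi, ← abs_div, abs_of_pos hi]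
      congr 1
      push_cast
      field_simp
    · refine tendsto_sq_div_of_le (fun i => sq_nonneg _) htop ?_
      filter_upwards [hdvd] with i hi
      exact h.intervalConv_sq_le _ _ (fun hh => hm ((hi m).1 hh))
  have hsum := tendsto_finsetSum (Finset.Icc (-B : ℤ) B) fun m _ => hterm m
  rw [sum_progression_eq_tsum hp q (Finset.Icc (-B : ℤ) B)
    (fun m => max 0 (1 - |1 + (2 * R - (m : ℝ) / p) / T|) ^ 2)] at hsum
  -- Reindexing the progression `p m + q` by `m` turns its offset into the shift of `R` by `-q /
  -- (2p)`.
  · have e : ∀ m : ℤ, 2 * R - ((p * m + q : ℤ) : ℝ) / p = 2 * (R - q / (2 * p)) - m := fun m => by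
      push_cast
      field_simp; ring
    simp only [e] at hsum
    refine hsum.congr' ?_
    have hlt : ∀ᶠ i in l, 2 * |(r i : ℝ) / (p * n i)| + 2 * ((t i : ℝ) / (p * n i)) < B / p :=
      ((hr.abs.const_mul 2).add (ht.const_mul 2)).eventually_lt_const
        (by rw [lt_div_iff₀ hp']; linarith)
    filter_upwards [hlt, hn.eventually_gt_atTop 0] with i h1 h2
    have hpn : (0 : ℝ) < p * n i := by positivity
    rw [abs_div, abs_of_pos hpn, ← mul_div_assoc, ← mul_div_assoc, ← add_div,
      div_lt_div_iff₀ hpn hp'] at h1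
    have h3 : 2 * |r i| + 2 * t i ≤ B * n i := by
      have : (2 * |(r i : ℝ)| + 2 * t i) * p < B * n i * p := by linarith
      exact_mod_cast (lt_of_mul_lt_mul_right this hp'.le).le
    rw [weightedCount_add_eq (by exact_mod_cast h2) h3, ← Finset.sum_div]
    push_cast; rfl
  · intro m hm
    have h1 : (B : ℤ) ≤ |m| := by
      rw [Finset.mem_Icc, ← abs_le] at hm
      omega
    have h2 : (B : ℝ) ≤ |(m : ℝ)| := by exact_mod_cast h1
    have h3 : 2 * |R| + 2 * T ≤ |(m : ℝ) / p| := by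
      rw [abs_div, abs_of_pos hp', le_div_iff₀ hp']; linarith
    -- Because `m / p` need not be an integer, it is absorbed into `R`, and the vanishing criterion
    -- is used at index 0.
    have h4 := gTerm_eq_zero (R := R - (m : ℝ) / (2 * p)) hT (m := 0) (by
      rw [Int.cast_zero, mul_sub, show 2 * ((m : ℝ) / (2 * p)) = m / p by field_simp]
      rcases le_abs.1 h3 with h | h
      · right; linarith [le_abs_self R]
      · left; linarith [neg_abs_le R])
    rw [Int.cast_zero, mul_sub, show 2 * ((m : ℝ) / (2 * p)) = m / p by field_simp, sub_zero] at h4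
    exact h4

end Limits

/-! ### The subtracted term, the error term and the general limit -/

/-- With `y = t / p` the sum is `p ^ 2 * (y ^ 2 + 2 ∑_{m ≥ 1} max 0 (y - m) ^ 2)`. Comparison with
the cubic at `y - 1` gives `(2 y ^ 3 + y) / 3`, with error `2/60`. -/
lemma abs_sum_progression_sub_le {p t : ℕ} (hp : 0 < p) (ht : 0 < t) :
    |∑ u ∈ Finset.Ioo (-t : ℤ) t, (if (p : ℤ) ∣ u - 0 then max 0 ((t : ℝ) - |(u : ℝ)|) ^ 2 else 0)
      - (p : ℝ) ^ 2 * ((2 * ((t : ℝ) / p) ^ 3 + (t : ℝ) / p) / 3)| ≤ (p : ℝ) ^ 2 / 30 := by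
  have hp' : (0 : ℝ) < p := by exact_mod_cast hp
  have ht' : (0 : ℝ) < t := by exact_mod_cast ht
  have hzero : ∀ m ∉ Finset.Ioo (-t : ℤ) t, max 0 ((t : ℝ) - |(m : ℝ)|) ^ 2 = 0 := by
    intro m hm
    have h1 : (t : ℤ) ≤ |m| := by
      rw [Finset.mem_Ioo, ← abs_lt] at hm
      omega
    have h2 : (t : ℝ) ≤ |(m : ℝ)| := by exact_mod_cast h1
    rw [max_eq_left (by linarith)]; norm_num
  rw [sum_progression_eq_tsum hp 0 _ (fun u => max 0 ((t : ℝ) - |(u : ℝ)|) ^ 2) hzero,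
    tsum_eq_sum (s := Finset.Ioo (-t : ℤ) t), sum_Ioo_even _ (fun u => by simp) ht]
  · obtain ⟨k, rfl⟩ : ∃ k, t = k + 1 := ⟨t - 1, by omega⟩
    have hy : ((k + 1 : ℕ) : ℝ) / p - 1 ≤ k := by
      rw [sub_le_iff_le_add, div_le_iff₀ hp']
      have : (1 : ℝ) ≤ p := by exact_mod_cast hp
      push_cast
      nlinarith [(Nat.cast_nonneg k : (0 : ℝ) ≤ k)]
    have hc := abs_sum_sq_sub_cubic_le k (((k + 1 : ℕ) : ℝ) / p - 1)
      (by have : 0 ≤ ((k + 1 : ℕ) : ℝ) / p := by positivity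
          linarith) hy
    have e : ∑ m ∈ Finset.Icc 1 (k + 1 - 1),
        max 0 (((k + 1 : ℕ) : ℝ) - |(((p : ℤ) * ((m : ℕ) : ℤ) + 0 : ℤ) : ℝ)|) ^ 2
        = (p : ℝ) ^ 2 * ∑ m ∈ Finset.range k, max 0 (((k + 1 : ℕ) : ℝ) / p - 1 - m) ^ 2 := by
      rw [Nat.add_sub_cancel, Finset.range_eq_Ico, Finset.mul_sum,
        show Finset.Icc 1 k = Finset.Ico (0 + 1) (k + 1) from rfl,
        ← Finset.sum_Ico_add' (fun m : ℕ =>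
          max 0 (((k + 1 : ℕ) : ℝ) - |(((p : ℤ) * ((m : ℕ) : ℤ) + 0 : ℤ) : ℝ)|) ^ 2) 0 k 1]
      refine Finset.sum_congr rfl fun m _ => ?_
      rw [← mul_pow, mul_max_of_nonneg _ _ hp'.le, mul_zero]
      congr 2
      push_cast
      rw [add_zero, abs_of_nonneg (by positivity)]
      field_simp
      ring
    rw [e]
    set S := ∑ m ∈ Finset.range k, max 0 (((k + 1 : ℕ) : ℝ) / p - 1 - m) ^ 2
    have hk : max 0 (((k + 1 : ℕ) : ℝ) - |(((p : ℤ) * 0 + 0 : ℤ) : ℝ)|) ^ 2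
        = (p : ℝ) ^ 2 * (((k + 1 : ℕ) : ℝ) / p) ^ 2 := by
      have : (0 : ℝ) ≤ ((k + 1 : ℕ) : ℝ) := by positivity
      simp only [mul_zero, add_zero, Int.cast_zero, abs_zero, sub_zero]
      rw [max_eq_right this]; field_simp
    rw [hk]
    set y := ((k + 1 : ℕ) : ℝ) / p
    rw [show (p : ℝ) ^ 2 * y ^ 2 + 2 * ((p : ℝ) ^ 2 * S) - (p : ℝ) ^ 2 * ((2 * y ^ 3 + y) / 3)
      = (p : ℝ) ^ 2 * 2 * (S - (y - 1) * (y - 1 + 1) * (2 * (y - 1) + 1) / 6) by ring, abs_mul,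
      abs_of_pos (by positivity)]
    nlinarith [mul_le_mul_of_nonneg_left hc (by positivity : 0 ≤ (p : ℝ) ^ 2 * 2)]
  · intro m hm
    refine hzero _ fun h => hm ?_
    rw [Finset.mem_Ioo, ← abs_lt] at h ⊢
    rw [add_zero, abs_mul, Nat.abs_cast] at h
    have : (1 : ℤ) ≤ p := by exact_mod_cast hp
    nlinarith [abs_nonneg m]

lemma IsSignPattern.abs_weightedCount_true_sub_le {σ : ZMod 4 → ℤ} {p : ℕ} {q : ℤ}
    (h : IsSignPattern σ p q) (hp : 0 < p) (r : ℤ) {t : ℕ} (ht : 0 < t) :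
    |(weightedCount σ r t (fun _ => True) : ℝ)
      - (p : ℝ) ^ 2 * ((2 * ((t : ℝ) / p) ^ 3 + (t : ℝ) / p) / 3)| ≤ 32 * t + (p : ℝ) ^ 2 / 30 := by
  have h1 : |(weightedCount σ r t (fun _ => True) : ℝ) - ∑ u ∈ Finset.Ioo (-t : ℤ) t,
      (if (p : ℤ) ∣ u - 0 then max 0 ((t : ℝ) - |(u : ℝ)|) ^ 2 else 0)| ≤ 32 * t := by
    rw [weightedCount_true_eq]
    push_cast
    rw [← Finset.sum_sub_distrib]
    refine (Finset.abs_sum_le_sum_abs _ _).trans ?_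
    have : ∀ u ∈ Finset.Ioo (-t : ℤ) t, |(intervalCorr (fun x => σ x) r t u : ℝ) ^ 2
        - (if (p : ℤ) ∣ u - 0 then max 0 ((t : ℝ) - |(u : ℝ)|) ^ 2 else 0)| ≤ 16 := by
      intro u _
      rw [sub_zero]
      split_ifs with hu
      · rw [h.intervalCorr_sq r t hu, sub_self, abs_zero]; norm_num
      · rw [sub_zero, abs_of_nonneg (sq_nonneg _)]
        exact h.intervalCorr_sq_le r t hu
    refine (Finset.sum_le_sum this).trans ?_
    rw [Finset.sum_const, Int.card_Ioo, nsmul_eq_mul]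
    have : ((((t : ℤ) - -(t : ℤ) - 1).toNat : ℕ) : ℝ) ≤ 2 * t := by
      exact_mod_cast (by omega : ((t : ℤ) - -(t : ℤ) - 1).toNat ≤ 2 * t)
    linarith
  have h2 := abs_sum_progression_sub_le hp ht
  exact (abs_sub_le _ _ _).trans (add_le_add h1 h2)

section Limits

variable {ι : Type*} {l : Filter ι} {n : ι → ℕ} {t : ι → ℕ} {r : ι → ℤ} {σ : ZMod 4 → ℤ} {p : ℕ}
  {q : ℤ} {R T : ℝ}

lemma tendsto_weightedCount_true (h : IsSignPattern σ p q) (hp : 0 < p) (hT : 0 < T)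
    (hn : Tendsto (fun i => (n i : ℝ)) l atTop)
    (ht : Tendsto (fun i => (t i : ℝ) / (p * n i)) l (𝓝 T)) :
    Tendsto (fun i => (2 / n i * weightedCount σ (r i) (t i) (fun _ => True) : ℝ)
      / (t i : ℝ) ^ 2) l (𝓝 (4 * T / 3)) := by
  have hp' : (0 : ℝ) < p := by exact_mod_cast hp
  have htop := tendsto_size_atTop hp hT hn ht
  have hmain : Tendsto (fun i => 4 * ((t i : ℝ) / (p * n i)) / 3) l (𝓝 (4 * T / 3)) :=
    (ht.const_mul 4).div_const 3
  have hC : Tendsto (fun i => 2 * (p / 3 + 32 + (p : ℝ) ^ 2 / 30) / (n i : ℝ)) l (𝓝 0) :=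
    tendsto_const_nhds.div_atTop hn
  refine tendsto_of_tendsto_of_dist hmain (squeeze_zero' (Eventually.of_forall fun _ => dist_nonneg) ?_ hC)
  filter_upwards [htop.eventually_ge_atTop 1, hn.eventually_gt_atTop 0] with i hi hni
  have hb := h.abs_weightedCount_true_sub_le hp (r i) (t := t i) (by exact_mod_cast hi)
  rw [dist_comm, Real.dist_eq]
  set W : ℝ := (weightedCount σ (r i) (t i) (fun _ => True) : ℝ)
  set τ : ℝ := (t i : ℝ)
  set ν : ℝ := (n i : ℝ)
  have hτ : 0 < τ := by linarith
  -- The cubic part of the approximation is exactly `4t / (3 p n)`; its linear part leaves `p * τ /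
  -- 3`, which is of lower order.
  have e : 2 / ν * W / τ ^ 2 - 4 * (τ / (p * ν)) / 3
      = 2 / (ν * τ ^ 2) * ((W - (p : ℝ) ^ 2 * ((2 * (τ / p) ^ 3 + τ / p) / 3)) + p * τ / 3) := by
    field_simp; ring
  rw [e, abs_mul, abs_of_pos (by positivity)]
  have h1 : |(W - (p : ℝ) ^ 2 * ((2 * (τ / p) ^ 3 + τ / p) / 3)) + p * τ / 3|
      ≤ (p / 3 + 32 + (p : ℝ) ^ 2 / 30) * τ ^ 2 := by
    refine (abs_add_le _ _).trans ?_
    rw [abs_of_pos (by positivity : (0 : ℝ) < p * τ / 3)]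
    have h2 : τ ≤ τ ^ 2 := by nlinarith
    have h3 : (1 : ℝ) ≤ τ ^ 2 := by nlinarith
    nlinarith [mul_le_mul_of_nonneg_left h2 hp'.le, mul_le_mul_of_nonneg_left h3 (sq_nonneg (p : ℝ))]
  calc _ ≤ 2 / (ν * τ ^ 2) * ((p / 3 + 32 + (p : ℝ) ^ 2 / 30) * τ ^ 2) := by gcongr
    _ = _ := by field_simp

lemma tendsto_error [∀ i, NeZero (n i)] {A : ∀ i, BinarySeq (n i)} (hp : 0 < p) (hT : 0 < T)
    (hn : Tendsto (fun i => (n i : ℝ)) l atTop)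
    (hdev : Tendsto (fun i => Real.log (n i) ^ 3 * maxDeviation (A i)) l (𝓝 0))
    (ht : Tendsto (fun i => (t i : ℝ) / (p * n i)) l (𝓝 T)) (hσ : ∀ y, |σ y| = 1) :
    Tendsto (fun i => ((signedEnergy (A i) σ (r i) (t i) : ℝ)
      - (weightedCount σ (r i) (t i) (fun x => (n i : ℤ) ∣ x.2.2.2 - x.2.1)
        + weightedCount σ (r i) (t i) (fun x => (n i : ℤ) ∣ x.2.2.1 - x.2.1)
        + weightedCount σ (r i) (t i) (fun x => (n i : ℤ) ∣ x.2.2.1 + x.2.2.2)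
        - 2 / n i * weightedCount σ (r i) (t i) (fun _ => True))) / (t i : ℝ) ^ 2) l (𝓝 0) := by
  have hp' : (0 : ℝ) < p := by exact_mod_cast hp
  have htop := tendsto_size_atTop hp hT hn ht
  have hratio := tendsto_size_ratio hp hT ht
  obtain ⟨B, hB⟩ := exists_nat_gt (p * T)
  have hlim : Tendsto (fun i => 2048 * (2 * B + 20 : ℝ) ^ 3 * ((n i : ℝ) / t i) ^ 2 *
      (Real.log (n i) ^ 3 * maxDeviation (A i))) l (𝓝 0) := by
    have := ((hratio.pow 2).const_mul (2048 * (2 * B + 20 : ℝ) ^ 3)).mul hdev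
    rwa [mul_zero] at this
  refine squeeze_zero_norm' ?_ hlim
  have hlt : ∀ᶠ i in l, (t i : ℝ) / (p * n i) < B / p :=
    ht.eventually_lt_const (by rw [lt_div_iff₀ hp']; linarith)
  filter_upwards [hlt, hn.eventually_ge_atTop 2, htop.eventually_gt_atTop 0] with i h1 h2 hti
  have hn0 : (0 : ℝ) < n i := by linarith
  have hlog : 1 / 2 ≤ Real.log (n i) := by
    have := Real.log_le_log two_pos h2
    linarith [Real.log_two_gt_d9]
  have htB : (t i : ℝ) ≤ B * n i := by
    rw [div_lt_div_iff₀ (by positivity) hp'] at h1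
    have : (t i : ℝ) * p < B * n i * p := by linarith
    exact (lt_of_mul_lt_mul_right this hp'.le).le
  have hlog4 : Real.log (4 * n i : ℕ) ≤ 3 * Real.log (n i) := by
    push_cast
    rw [Real.log_mul (by norm_num) hn0.ne', show (4 : ℝ) = 2 ^ 2 by norm_num, Real.log_pow]
    have := Real.log_le_log two_pos h2
    push_cast
    linarith
  -- Here `t ≤ B n ≤ 2 B n log n` because `log n ≥ 1/2`, and `1 + log (4n) ≤ 5 log n`, whence `2B +
  -- 20`. Its cube over `n`, compared with `t ^ 2`, leaves exactly `(log n) ^ 3` times the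
  -- deviation.
  have hQ : ∀ ζ : ℂ, ζ ^ 4 = 1 → ∑ a : ZMod (n i), geomBound (t i) (ζ * ZMod.stdAddChar a)
      ≤ (2 * B + 20) * (n i * Real.log (n i)) := by
    intro ζ hζ
    refine (sum_geomBound_stdAddChar_le (Nat.cast_nonneg _) (n i) hζ).trans ?_
    have a1 : (t i : ℝ) ≤ 2 * B * (n i * Real.log (n i)) := by
      have : (0 : ℝ) ≤ B * n i := by positivity
      nlinarith
    have a2 : ((4 * n i : ℕ) : ℝ) * (1 + Real.log (4 * n i : ℕ))
        ≤ 4 * n i * (5 * Real.log (n i)) := by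
      rw [Nat.cast_mul, Nat.cast_ofNat] at *
      gcongr
      linarith
    linarith
  have hmain := abs_signedEnergy_sub_le (A i) hσ (r i) (t i) hQ
  rw [Real.norm_eq_abs, abs_div, abs_of_pos (by positivity : (0 : ℝ) < (t i : ℝ) ^ 2),
    div_le_iff₀ (by positivity)]
  refine hmain.trans_eq ?_
  field_simp

/-- All three assertions are instances. The hypotheses `hdvd` and `hdvd'` say that multiplication by
`n` preserves membership in the progressions modulo `p`. -/
theorem tendsto_meritFactor [∀ i, NeZero (n i)] {A : ∀ i, BinarySeq (n i)}
    (h : IsSignPattern σ p q) (hp : 0 < p) (hT : 0 < T)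
    (hn : Tendsto (fun i => (n i : ℝ)) l atTop)
    (hdev : Tendsto (fun i => Real.log (n i) ^ 3 * maxDeviation (A i)) l (𝓝 0))
    (hdvd : ∀ᶠ i in l, ∀ m : ℤ, (p : ℤ) ∣ m * n i ↔ (p : ℤ) ∣ m)
    (hdvd' : ∀ᶠ i in l, ∀ m : ℤ, (p : ℤ) ∣ m * n i - q ↔ (p : ℤ) ∣ m - q)
    (hr : Tendsto (fun i => (r i : ℝ) / (p * n i)) l (𝓝 R))
    (ht : Tendsto (fun i => (t i : ℝ) / (p * n i)) l (𝓝 T))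
    (b : ∀ i, BinarySeq (t i))
    (hb : ∀ i, ∀ j : Fin (t i), (b i j : ℤ) = σ (((j : ℕ) + r i : ℤ) : ZMod 4) *
      ((A i).periodicExt ((j : ℕ) + r i) : ℤ)) :
    Tendsto (fun i => (b i).meritFactor) l (𝓝 (gLimit (R - q / (2 * p)) T)) := by
  have htop := tendsto_size_atTop hp hT hn ht
  have l0 := tendsto_error (r := r) hp hT hn hdev ht h.abs_eq_one
  have l1 := tendsto_weightedCount_sub (r := r) h hp hT hn hdvd ht
  have l3 := tendsto_weightedCount_add h hp hT hn hdvd' hr ht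
  have l4 := tendsto_weightedCount_true (r := r) h hp hT hn ht
  have hE := ((((l0.add l1).add l1).add l3).sub l4).sub_const 1
  have hlim : Tendsto (fun i => (signedEnergy (A i) σ (r i) (t i) : ℝ) / (t i : ℝ) ^ 2 - 1) l
      (𝓝 (gRecip (R - q / (2 * p)) T)) := by
    have e : ∀ P Q : ℝ, 0 + (1 + 2 * P) + (1 + 2 * P) + Q - 4 * T / 3 - 1
        = 1 - 4 * T / 3 + 4 * P + Q := fun P Q => by ring
    rw [e] at hE
    refine hE.congr fun i => ?_
    rw [weightedCount_sub_swap]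
    ring
  have hF := hlim.inv₀ (gRecip_pos _ hT).ne'
  rw [← one_div] at hF
  refine hF.congr' ?_
  filter_upwards [htop.eventually_gt_atTop 0] with i hi
  have hi' : 0 < t i := by exact_mod_cast hi
  have hs := BinarySeq.two_mul_sum_autocorr_sq hi' (b i)
    (fun x => σ x * ((A i).periodicExt x : ℤ)) (r i) (hb i) (fun x => by
      rw [mul_pow, ← sq_abs, h.abs_eq_one, one_pow, one_mul]
      rcases Int.units_eq_one_or ((A i).periodicExt x) with hx | hx <;> rw [hx] <;> norm_num)
  rw [← signedEnergy_eq] at hs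
  have hs' : 2 * ∑ u ∈ Finset.Icc 1 (t i - 1), ((b i).autocorr u : ℝ) ^ 2
      = (signedEnergy (A i) σ (r i) (t i) : ℝ) - (t i : ℝ) ^ 2 := by exact_mod_cast hs
  rw [BinarySeq.meritFactor, hs', ← inv_div (_ - _), sub_div, div_self (by positivity)]

end Limits

/-! ### The three sign patterns -/

/-- The signs `+,+,-,-` of the negaperiodic construction. -/
def negaperiodicSign (y : ZMod 4) : ℤ := if y = 0 ∨ y = 1 then 1 else -1

/-- The signs `+,+,-,+` of the periodic construction. -/
def periodicSign (y : ZMod 4) : ℤ := if y = 2 then -1 else 1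

/-- As `p ∣ 4`, divisibility by `p` depends only on the residue modulo 4, so every condition becomes
a finite check. The sign `e` is the value at `y = 0`. -/
lemma IsSignPattern.of_zmod {σ : ZMod 4 → ℤ} {p : ℕ} {q : ℤ} (hp4 : p ∣ 4)
    (h : ∀ y, |σ y| = 1)
    (hc : ∀ u : ZMod 4, p ∣ u.val → ∀ y, σ (y + u) * σ y = σ (0 + u) * σ 0)
    (hc0 : ∀ u : ZMod 4, ¬ p ∣ u.val → ∑ y, σ (y + u) * σ y = 0)
    (hd : ∀ v : ZMod 4, p ∣ v.val → ∀ y, σ (v + q - y) * σ y = σ (v + q - 0) * σ 0)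
    (hd0 : ∀ v : ZMod 4, ¬ p ∣ v.val → ∑ y, σ (v + q - y) * σ y = 0) : IsSignPattern σ p q := by
  have hdvd : ∀ u : ℤ, (p : ℤ) ∣ u ↔ p ∣ (u : ZMod 4).val := fun u => by
    rw [← Int.natCast_dvd_natCast, ZMod.val_intCast]
    rw [Int.emod_def, dvd_sub_left (Dvd.dvd.mul_right (by exact_mod_cast hp4) _)]
  have hsq : ∀ y z, (σ y * σ z) ^ 2 = 1 := fun y z => by
    rw [← sq_abs, abs_mul, h, h]; norm_num
  have hcast : ∀ v : ℤ, ((v - q : ℤ) : ZMod 4) + q = v := fun v => by push_cast; ring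
  refine ⟨h, fun u hu => ⟨_, hsq _ _, hc u ((hdvd u).1 hu)⟩, fun u hu => hc0 u (mt (hdvd u).2 hu),
    fun v hv => ?_, fun v hv => ?_⟩
  · rw [← hcast v]
    exact ⟨_, hsq _ _, hd _ ((hdvd _).1 hv)⟩
  · have := hd0 _ (mt (hdvd _).2 hv)
    rwa [hcast] at this

lemma isSignPattern_one : IsSignPattern (fun _ => 1) 1 0 :=
  .of_zmod (by norm_num) (by decide) (by decide) (by decide) (by decide) (by decide)

lemma isSignPattern_negaperiodicSign : IsSignPattern negaperiodicSign 2 (-1) :=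
  .of_zmod (by norm_num) (by decide) (by decide) (by decide) (by decide) (by decide)

lemma isSignPattern_periodicSign : IsSignPattern periodicSign 4 0 :=
  .of_zmod (by norm_num) (by decide) (by decide) (by decide) (by decide) (by decide)

lemma neg_one_pow_eq_negaperiodicSign (x : ℕ) :
    (((-1 : ℤˣ) ^ (x * (x - 1) / 2) : ℤˣ) : ℤ) = negaperiodicSign (x : ZMod 4) := by
  have hx : (x : ZMod 4) = ((x % 4 : ℕ) : ZMod 4) := by simp
  rw [hx]
  obtain ⟨k, i, hi, rfl⟩ : ∃ k i, i < 4 ∧ x = 4 * k + i :=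
    ⟨x / 4, x % 4, Nat.mod_lt _ (by norm_num), by omega⟩
  rw [show (4 * k + i) % 4 = i by omega]
  interval_cases i
  -- The case `x = 0` is separate because `x - 1` is truncated there.
  · rcases k with _ | k
    · simp [negaperiodicSign]
    · rw [show (4 * (k + 1) + 0) * (4 * (k + 1) + 0 - 1) / 2 = 2 * ((k + 1) * (4 * k + 3)) from
        Nat.div_eq_of_eq_mul_left two_pos (by
          rw [show 4 * (k + 1) + 0 - 1 = 4 * k + 3 by omega]; ring), pow_mul]
      norm_num [negaperiodicSign]
  · rw [show (4 * k + 1) * (4 * k + 1 - 1) / 2 = 2 * (k * (4 * k + 1)) from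
      Nat.div_eq_of_eq_mul_left two_pos (by rw [Nat.add_sub_cancel]; ring), pow_mul]
    norm_num [negaperiodicSign]
  · rw [show (4 * k + 2) * (4 * k + 2 - 1) / 2 = 2 * (4 * k ^ 2 + 3 * k) + 1 from
      Nat.div_eq_of_eq_mul_left two_pos (by
        rw [show 4 * k + 2 - 1 = 4 * k + 1 by omega]; ring), pow_succ, pow_mul]
    norm_num
    decide
  · rw [show (4 * k + 3) * (4 * k + 3 - 1) / 2 = 2 * (4 * k ^ 2 + 5 * k + 1) + 1 from
      Nat.div_eq_of_eq_mul_left two_pos (by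
        rw [show 4 * k + 3 - 1 = 4 * k + 2 by omega]; ring), pow_succ, pow_mul]
    norm_num
    decide

lemma neg_one_pow_eq_periodicSign (x : ℕ) :
    (((-1 : ℤˣ) ^ (x * (x - 1) ^ 2 / 2) : ℤˣ) : ℤ) = periodicSign (x : ZMod 4) := by
  have hx : (x : ZMod 4) = ((x % 4 : ℕ) : ZMod 4) := by simp
  rw [hx]
  obtain ⟨k, i, hi, rfl⟩ : ∃ k i, i < 4 ∧ x = 4 * k + i :=
    ⟨x / 4, x % 4, Nat.mod_lt _ (by norm_num), by omega⟩
  rw [show (4 * k + i) % 4 = i by omega]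
  interval_cases i
  · rcases k with _ | k
    · simp; decide
    · rw [show (4 * (k + 1) + 0) * (4 * (k + 1) + 0 - 1) ^ 2 / 2
          = 2 * ((k + 1) * (4 * k + 3) ^ 2) from
        Nat.div_eq_of_eq_mul_left two_pos (by
          rw [show 4 * (k + 1) + 0 - 1 = 4 * k + 3 by omega]; ring), pow_mul]
      norm_num
      decide
  · rw [show (4 * k + 1) * (4 * k + 1 - 1) ^ 2 / 2 = 2 * (4 * k ^ 2 * (4 * k + 1)) from
      Nat.div_eq_of_eq_mul_left two_pos (by rw [Nat.add_sub_cancel]; ring), pow_mul]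
    norm_num
    decide
  · rw [show (4 * k + 2) * (4 * k + 2 - 1) ^ 2 / 2 = 2 * (16 * k ^ 3 + 16 * k ^ 2 + 5 * k) + 1 from
      Nat.div_eq_of_eq_mul_left two_pos (by
        rw [show 4 * k + 2 - 1 = 4 * k + 1 by omega]; ring), pow_succ, pow_mul]
    norm_num
    decide
  · rw [show (4 * k + 3) * (4 * k + 3 - 1) ^ 2 / 2 = 2 * ((4 * k + 3) * (2 * k + 1) ^ 2) from
      Nat.div_eq_of_eq_mul_left two_pos (by
        rw [show 4 * k + 3 - 1 = 4 * k + 2 by omega]; ring), pow_mul]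
    norm_num
    decide

namespace BinarySeq

variable {n : ℕ} [NeZero n]

lemma periodicExt_congr (A : BinarySeq n) {x y : ℤ} (h : x % n = y % n) :
    A.periodicExt x = A.periodicExt y := by
  simp only [periodicExt, h]

/-- Both periods, 4 and `n`, divide `4 * n`, so the sign and the entry can be read off after
reduction modulo `4 * n`. -/
lemma periodicExt_signed (A : BinarySeq n) (B : BinarySeq (4 * n)) (σ : ZMod 4 → ℤ)
    (hB : ∀ j : Fin (4 * n), (B j : ℤ) = σ (((j : ℕ) : ℕ) : ZMod 4) * (A.periodicExt (j : ℕ) : ℤ))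
    (x : ℤ) : (B.periodicExt x : ℤ) = σ (x : ZMod 4) * (A.periodicExt x : ℤ) := by
  have hn : (0 : ℤ) < (4 * n : ℕ) := by exact_mod_cast Nat.pos_of_ne_zero (NeZero.ne (4 * n))
  have h1 := Int.emod_nonneg x hn.ne'
  rw [periodicExt, hB]
  simp only
  have h2 : (((x % (4 * n : ℕ)).toNat : ℕ) : ZMod 4) = (x : ZMod 4) := by
    rw [← Int.cast_natCast, Int.toNat_of_nonneg h1, ZMod.intCast_eq_intCast_iff']
    exact Int.emod_emod_of_dvd x (by push_cast; exact Dvd.intro _ rfl)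
  rw [h2, Int.toNat_of_nonneg h1, A.periodicExt_congr (y := x)]
  exact Int.emod_emod_of_dvd x (by push_cast; exact Dvd.intro_left _ rfl)

lemma periodicExt_negaperiodic (A : BinarySeq n) (x : ℤ) :
    (A.negaperiodic.periodicExt x : ℤ) = negaperiodicSign (x : ZMod 4) * (A.periodicExt x : ℤ) :=
  periodicExt_signed A _ _ (fun j => by
    rw [negaperiodic, Units.val_mul, neg_one_pow_eq_negaperiodicSign]) x

lemma periodicExt_periodic (A : BinarySeq n) (x : ℤ) :
    (A.periodic.periodicExt x : ℤ) = periodicSign (x : ZMod 4) * (A.periodicExt x : ℤ) :=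
  periodicExt_signed A _ _ (fun j => by
    rw [periodic, Units.val_mul, neg_one_pow_eq_periodicSign]) x

end BinarySeq

/-! ### The theorem -/

lemma eventually_odd {S : Set ℕ+} (h : ∀ n ∈ S, Odd (n : ℕ)) :
    ∀ᶠ n : ℕ+ in atTop ⊓ 𝓟 S, Odd (n : ℕ) :=
  Filter.mem_of_superset (mem_inf_of_right (mem_principal_self S)) h

theorem mainTheorem5
    (S : Set ℕ+) (hS : S.Infinite)
    (V : (n : ℕ+) → BinarySeq n)
    (hV : Tendsto (fun n : ℕ+ => Real.log (n : ℝ) ^ 3 * maxDeviation (V n))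
      (atTop ⊓ 𝓟 S) (𝓝 0))
    (R T : ℝ) (hT : 0 < T) (r : ℕ+ → ℤ) (t : ℕ+ → ℕ) :
    (Tendsto (fun n : ℕ+ => (r n : ℝ) / (n : ℝ)) (atTop ⊓ 𝓟 S) (𝓝 R) →
      Tendsto (fun n : ℕ+ => (t n : ℝ) / (n : ℝ)) (atTop ⊓ 𝓟 S) (𝓝 T) →
      Tendsto (fun n : ℕ+ => ((V n).rotate (r n) (t n)).meritFactor)
        (atTop ⊓ 𝓟 S) (𝓝 (gLimit R T))) ∧
    ((∀ n ∈ S, Odd (n : ℕ)) →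
      Tendsto (fun n : ℕ+ => (r n : ℝ) / (2 * (n : ℝ))) (atTop ⊓ 𝓟 S) (𝓝 R) →
      Tendsto (fun n : ℕ+ => (t n : ℝ) / (2 * (n : ℝ))) (atTop ⊓ 𝓟 S) (𝓝 T) →
      Tendsto (fun n : ℕ+ => ((V n).negaperiodic.rotate (r n) (t n)).meritFactor)
        (atTop ⊓ 𝓟 S) (𝓝 (gLimit (R + 1 / 4) T))) ∧
    ((∀ n ∈ S, Odd (n : ℕ)) →
      Tendsto (fun n : ℕ+ => (r n : ℝ) / (4 * (n : ℝ))) (atTop ⊓ 𝓟 S) (𝓝 R) →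
      Tendsto (fun n : ℕ+ => (t n : ℝ) / (4 * (n : ℝ))) (atTop ⊓ 𝓟 S) (𝓝 T) →
      Tendsto (fun n : ℕ+ => ((V n).periodic.rotate (r n) (t n)).meritFactor)
        (atTop ⊓ 𝓟 S) (𝓝 (gLimit R T))) := by
  have hn : Tendsto (fun n : ℕ+ => ((n : ℕ) : ℝ)) (atTop ⊓ 𝓟 S) atTop :=
    (tendsto_natCast_atTop_atTop.comp tendsto_PNat_val_atTop_atTop).mono_left inf_le_left
  refine ⟨fun hr ht => ?_, fun hodd hr ht => ?_, fun hodd hr ht => ?_⟩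
  · have h := tendsto_meritFactor (n := fun n : ℕ+ => (n : ℕ)) (A := V) (R := R) (r := r)
      isSignPattern_one one_pos hT hn hV
      (Eventually.of_forall fun i m => by simp) (Eventually.of_forall fun i m => by simp)
      (by simpa using hr) (by simpa using ht) (fun n => (V n).rotate (r n) (t n))
      (fun n j => by rw [one_mul]; rfl)
    simpa using h
  · have h := tendsto_meritFactor (n := fun n : ℕ+ => (n : ℕ)) (A := V) (R := R) (r := r)
      isSignPattern_negaperiodicSign two_pos hT hn hV
      (by
        filter_upwards [eventually_odd hodd] with n hn m
        have h2 : Odd ((n : ℕ) : ℤ) := by exact_mod_cast hn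
        push_cast
        rw [← even_iff_two_dvd, ← even_iff_two_dvd, Int.even_mul]
        simp [Int.not_even_iff_odd.2 h2])
      (by
        filter_upwards [eventually_odd hodd] with n hn m
        have h2 : Odd ((n : ℕ) : ℤ) := by exact_mod_cast hn
        push_cast
        rw [← even_iff_two_dvd, ← even_iff_two_dvd, Int.even_sub, Int.even_sub, Int.even_mul]
        simp [Int.not_even_iff_odd.2 h2])
      (by exact_mod_cast hr) (by exact_mod_cast ht)
      (fun n => (V n).negaperiodic.rotate (r n) (t n))
      (fun n j => BinarySeq.periodicExt_negaperiodic (V n) _)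
    -- With `p = 2` and `q = -1` the shift is `-q / (2p) = 1/4`.
    convert h using 3
    push_cast; ring
  · have hdvd : ∀ᶠ n : ℕ+ in atTop ⊓ 𝓟 S, ∀ m : ℤ, ((4 : ℕ) : ℤ) ∣ m * ((n : ℕ) : ℤ) ↔ ((4 : ℕ) : ℤ) ∣ m := by
      filter_upwards [eventually_odd hodd] with n hn m
      -- Oddness of `n` makes it coprime to 4, so multiplication by `n` permutes the residues modulo
      -- 4.
      have hc : IsCoprime ((4 : ℕ) : ℤ) ((n : ℕ) : ℤ) := by
        rw [Nat.isCoprime_iff_coprime]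
        exact (Nat.coprime_two_left.2 hn).pow_left 2
      exact ⟨hc.dvd_of_dvd_mul_right, fun h => h.mul_right _⟩
    have h := tendsto_meritFactor (n := fun n : ℕ+ => (n : ℕ)) (A := V) (R := R) (r := r)
      isSignPattern_periodicSign four_pos hT hn hV hdvd (by simpa only [sub_zero] using hdvd)
      (by exact_mod_cast hr) (by exact_mod_cast ht)
      (fun n => (V n).periodic.rotate (r n) (t n))
      (fun n j => BinarySeq.periodicExt_periodic (V n) _)
    simpa using h
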